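/- An index is a finite (possibly empty) sequence of positive integers $\mathbf{k}=(k_1,\ldots,k_n)$; it is admissible if it is empty or $k_1>1$. For an admissible index put $$t(\mathbf{k})=\sum_{\substack{m_1>\cdots>m_n>0\\ m_i\ \mathrm{odd}}}\frac{1}{m_1^{k_1}\cdots m_n^{k_n}},\qquad t^\star(\mathbf{k})=\sum_{\substack{m_1\ge\cdots\ge m_n>0\\ m_i\ \mathrm{odd}}}\frac{1}{m_1^{k_1}\cdots m_n^{k_n}},\qquad t(\varnothing)=t^\star(\varnothing)=1.$$ Let $\mathfrak{A}^1=\mathbb{Q}+\mathbb{Q}\langle x,y\rangle y$, with basis the words $z_{k_1}\cdots z_{k_n}$, where $z_k=x^{k-1}y$. The stuffle product $\ast$ on $\mathfrak{A}^1$ is the $\mathbb{Q}$-bilinear product with $1\ast w=w\ast 1=w$ and $$z_kw_1\ast z_lw_2=z_k(w_1\ast z_lw_2)+z_l(z_kw_1\ast w_2)+z_{k+l}(w_1\ast w_2)$$ for words $w,w_1,w_2$ of $\mathfrak{A}^1$. For $V\in\mathbb{R}$ let $t_\ast^V:(\mathfrak{A}^1,\ast)\to\mathbb{R}$ be the stuffle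 regularization, that is, the unique $\mathbb{Q}$-algebra homomorphism with $t_\ast^V(z_1)=V$ and $t_\ast^V(z_{k_1}\cdots z_{k_n})=t(k_1,\ldots,k_n)$ for every admissible index. Let $S:\mathfrak{A}^1\to\mathfrak{A}^1$ be the $\mathbb{Q}$-linear map with $S(1)=1$ and $S(wy)=\gamma(w)y$ for every word $w$ in $x,y$, where $\gamma$ is the automorphism of the algebra $\mathbb{Q}\langle x,y\rangle$ with $\gamma(x)=x$, $\gamma(y)=x+y$. The star-stuffle regularized values are $$t^{\star,V}_{\overline\ast}(k_1,\ldots,k_n)=t_\ast^V\bigl(S(z_{k_1}\cdots z_{k_n})\bigr).$$ Theorem. For all $V\in\mathbb{R}$ and all integers $a,b\ge 0$, $$t^{\star,V}_{\overline\ast}(\{2\}^a,1,\{2\}^b)=\sum_{r=1}^{a+b}2^{-2r}\left[\binom{2r}{2a}+(1-2^{-2r})\binom{2r}{2b}\right]t^\star(\{2\}^{a+b-r})\,\zeta(2r+1)+\delta_{a=0}(V-\log 2)\,t^\star(\{2\}^b)+\delta_{b=0}\log 2\;t^\star(\{2\}^a),$$ where $\{2\}^n$ denotes $n$ repetitions of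 $2$, $\zeta$ is the Riemann zeta function, and $\delta_{c=0}$ is $1$ if $c=0$ and $0$ otherwise. -/

import Mathlib

namespace MultipleT

/-! Multiple `t`-values, multiple `t`-star values, the stuffle algebra, and the regularizations. -/

/-- An index `(k₁, …, kₙ)`: a finite, possibly empty, sequence of positive integers. -/
abbrev Index := List ℕ+

/-- An index is admissible if it is empty or its first entry is greater than one. -/
def Admissible : Index → Prop
  | [] => True
  | k :: _ => 1 < k

/-- The multiple `t`-value `t(k₁, …, kₙ) = ∑ 1 / (m₁ ^ k₁ ⋯ mₙ ^ kₙ)`, the sum over all odd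
`m₁ > ⋯ > mₙ > 0`. All terms are positive, and the series converges for admissible indices. -/
noncomputable def t (k : Index) : ℝ :=
  ∑' m : {m : Fin k.length → ℕ // StrictAnti m ∧ ∀ i, Odd (m i)},
    ∏ i, 1 / (m.1 i : ℝ) ^ (k.get i : ℕ)

/-- The multiple `t`-star value `t⋆(k₁, …, kₙ) = ∑ 1 / (m₁ ^ k₁ ⋯ mₙ ^ kₙ)`, the sum over all odd
`m₁ ≥ ⋯ ≥ mₙ > 0`. -/
noncomputable def tStar (k : Index) : ℝ :=
  ∑' m : {m : Fin k.length → ℕ // Antitone m ∧ ∀ i, Odd (m i)},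
    ∏ i, 1 / (m.1 i : ℝ) ^ (k.get i : ℕ)

/-- The space `𝔄¹ = ℚ + ℚ⟨x, y⟩y`, written in its basis of words `z_{k₁} ⋯ z_{kₙ}`,
where `z_k = x ^ (k - 1) y`. -/
abbrev Words := Index →₀ ℚ

/-- The word `z_{k₁} ⋯ z_{kₙ}` as an element of `𝔄¹`. -/
noncomputable abbrev word (k : Index) : Words := Finsupp.single k 1

/-- Left concatenation with the letter `z_k`. -/
noncomputable def prepend (k : ℕ+) : Words →ₗ[ℚ] Words :=
  Finsupp.lmapDomain ℚ ℚ (List.cons k)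

/-- The stuffle product of two words. -/
noncomputable def stuffleWord : Index → Index → Words
  | [], v => word v
  | k :: u, [] => word (k :: u)
  | k :: u, l :: v =>
      prepend k (stuffleWord u (l :: v)) + prepend l (stuffleWord (k :: u) v)
        + prepend (k + l) (stuffleWord u v)
  termination_by u v => u.length + v.length

/-- The stuffle product `∗` on `𝔄¹`, extended bilinearly from words. -/
noncomputable def stuffle : Words →ₗ[ℚ] Words →ₗ[ℚ] Words :=
  Finsupp.linearCombination ℚ fun u => Finsupp.linearCombination ℚ (stuffleWord u)

/-- `φ` is a stuffle regularization of the multiple `t`-values with parameter `V`: an algebra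
homomorphism from `(𝔄¹, ∗)` to `ℝ` that extends `t` from the admissible words (the empty word
included, so that it is unital) and sends `z₁` to `V`. -/
structure IsStuffleRegularization (V : ℝ) (φ : Words →ₗ[ℚ] ℝ) : Prop where
  map_stuffle : ∀ u v : Words, φ (stuffle u v) = φ u * φ v
  map_admissible : ∀ k : Index, Admissible k → φ (word k) = t k
  map_z_one : φ (word [1]) = V

/-! ### Existence and uniqueness of the stuffle regularization -/

lemma prepend_word (k : ℕ+) (u : Index) (c : ℚ) :
    prepend k (Finsupp.single u c) = Finsupp.single (k :: u) c := by
  simp [prepend, Finsupp.lmapDomain_apply, Finsupp.mapDomain_single]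

lemma stuffle_word (u v : Index) : stuffle (word u) (word v) = stuffleWord u v := by
  simp [stuffle, word]

lemma words_induction {P : Words → Prop} (h0 : P 0) (ha : ∀ x y, P x → P y → P (x + y))
    (hs : ∀ (c : ℚ) x, P x → P (c • x)) (hw : ∀ u, P (word u)) (x : Words) : P x := by
  induction x using Finsupp.induction_linear with
  | zero => exact h0
  | add f g hf hg => exact ha _ _ hf hg
  | single u c =>
    have := hs c _ (hw u)
    simpa [word] using this

lemma stuffle_one_left (x : Words) : stuffle (word []) x = x := by
  refine words_induction (P := fun x => stuffle (word []) x = x) ?_ ?_ ?_ ?_ x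
  · simp
  · intro x y hx hy; rw [map_add, hx, hy]
  · intro c x hx; rw [map_smul, hx]
  · intro u; rw [stuffle_word, stuffleWord]

lemma stuffle_one_right (x : Words) : stuffle x (word []) = x := by
  refine words_induction (P := fun x => stuffle x (word []) = x) ?_ ?_ ?_ ?_ x
  · simp
  · intro x y hx hy; rw [map_add, LinearMap.add_apply, hx, hy]
  · intro c x hx; rw [map_smul, LinearMap.smul_apply, hx]
  · intro u; rw [stuffle_word]; cases u <;> rw [stuffleWord]

lemma stuffle_prepend (k l : ℕ+) (x y : Words) :
    stuffle (prepend k x) (prepend l y) = prepend k (stuffle x (prepend l y))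
      + prepend l (stuffle (prepend k x) y) + prepend (k + l) (stuffle x y) := by
  refine words_induction (P := fun x => stuffle (prepend k x) (prepend l y)
    = prepend k (stuffle x (prepend l y))
      + prepend l (stuffle (prepend k x) y) + prepend (k + l) (stuffle x y)) ?_ ?_ ?_ ?_ x
  · simp
  · intro x x' hx hx'
    simp only [map_add, LinearMap.add_apply, hx, hx']; abel
  · intro c x hx
    simp only [map_smul, LinearMap.smul_apply, hx, smul_add]
  · intro u
    refine words_induction (P := fun y => stuffle (prepend k (word u)) (prepend l y)
      = prepend k (stuffle (word u) (prepend l y))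
      + prepend l (stuffle (prepend k (word u)) y) + prepend (k + l) (stuffle (word u) y))
      ?_ ?_ ?_ ?_ y
    · simp
    · intro x x' hx hx'
      simp only [map_add, hx, hx']; abel
    · intro c x hx
      simp only [map_smul, hx, smul_add]
    · intro v
      simp only [word, prepend_word]
      simp only [stuffle_word]
      rw [stuffleWord]

lemma stuffleWord_comm (u v : Index) : stuffleWord u v = stuffleWord v u := by
  induction u, v using stuffleWord.induct with
  | case1 v => cases v <;> simp [stuffleWord]
  | case2 k u => simp [stuffleWord]
  | case3 k u l v h1 h2 h3 =>
    rw [stuffleWord, stuffleWord, h1, h2, h3, add_comm l k]; abel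

lemma stuffle_comm (x y : Words) : stuffle x y = stuffle y x := by
  refine words_induction (P := fun x => stuffle x y = stuffle y x) ?_ ?_ ?_ ?_ x
  · simp
  · intro x x' hx hx'; simp [hx, hx']
  · intro c x hx; simp [hx]
  · intro u
    refine words_induction (P := fun y => stuffle (word u) y = stuffle y (word u)) ?_ ?_ ?_ ?_ y
    · simp
    · intro x x' hx hx'; simp [hx, hx']
    · intro c x hx; simp [hx]
    · intro v; rw [stuffle_word, stuffle_word, stuffleWord_comm]

lemma prepend_one_word_nil : word [1] = prepend 1 (word []) := by
  simp [word, prepend_word]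

lemma stuffle_z_one_prepend (k : ℕ+) (x : Words) :
    stuffle (word [1]) (prepend k x)
      = prepend 1 (prepend k x) + prepend k (stuffle (word [1]) x) + prepend (k + 1) x := by
  rw [prepend_one_word_nil, stuffle_prepend, stuffle_one_left, stuffle_one_left, add_comm k 1]

lemma stuffle_z_one_assoc (u v : Index) :
    stuffle (word [1]) (stuffleWord u v) = stuffle (stuffle (word [1]) (word u)) (word v) := by
  induction u, v using stuffleWord.induct with
  | case1 v => rw [stuffleWord, stuffle_one_right]
  | case2 k u => rw [stuffleWord, stuffle_one_right]
  | case3 k u l v h1 h2 h3 =>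
    have e1 : word (k :: u) = prepend k (word u) := by simp [word, prepend_word]
    have e2 : word (l :: v) = prepend l (word v) := by simp [word, prepend_word]
    rw [stuffleWord]
    simp only [map_add, stuffle_z_one_prepend, h1, h2, h3]
    rw [e1, e2]
    simp only [stuffle_z_one_prepend, map_add, LinearMap.add_apply, stuffle_prepend]
    simp only [← stuffle_word, e1, e2]
    rw [add_comm 1 l, add_right_comm k 1 l]
    abel

/-- The number of leading ones of an index. -/
def lead : Index → ℕ
  | [] => 0
  | k :: u => if k = 1 then lead u + 1 else 0

lemma lead_eq_zero_iff (u : Index) : lead u = 0 ↔ Admissible u := by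
  cases u with
  | nil => simp [lead, Admissible]
  | cons k u =>
    simp only [lead, Admissible]
    have : 1 ≤ k := one_le
    split_ifs with h
    · simp [h]
    · simp only [true_iff]; exact lt_of_le_of_ne this (Ne.symm h)

/-- The span of the words with at most `p` leading ones. -/
noncomputable def leadLE (p : ℕ) : Submodule ℚ Words := Finsupp.supported ℚ ℚ {u | lead u ≤ p}

lemma leadLE_mono {p q : ℕ} (h : p ≤ q) : leadLE p ≤ leadLE q :=
  Finsupp.supported_mono fun _ hu => le_trans hu h

lemma word_mem_leadLE {u : Index} {p : ℕ} (h : lead u ≤ p) : word u ∈ leadLE p :=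
  Finsupp.single_mem_supported ℚ _ h

lemma leadLE_induction {p : ℕ} {P : Words → Prop} (h0 : P 0)
    (ha : ∀ x y, P x → P y → P (x + y)) (hs : ∀ (c : ℚ) x, P x → P (c • x))
    (hw : ∀ u, lead u ≤ p → P (word u)) {x : Words} (hx : x ∈ leadLE p) : P x := by
  rw [leadLE, Finsupp.supported_eq_span_single] at hx
  induction hx using Submodule.span_induction with
  | mem x h => obtain ⟨u, hu, rfl⟩ := h; exact hw u hu
  | zero => exact h0
  | add x y _ _ hx hy => exact ha _ _ hx hy
  | smul c x _ hx => exact hs _ _ hx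

lemma prepend_mem_leadLE (k : ℕ+) (hk : k ≠ 1) (x : Words) (p : ℕ) : prepend k x ∈ leadLE p := by
  refine words_induction (P := fun x => prepend k x ∈ leadLE p) ?_ ?_ ?_ ?_ x
  · simp
  · intro x y hx hy; rw [map_add]; exact add_mem hx hy
  · intro c x hx; rw [map_smul]; exact Submodule.smul_mem _ _ hx
  · intro u; rw [word, prepend_word]; exact word_mem_leadLE (by simp [lead, hk])

lemma prepend_one_mem_leadLE {x : Words} {p : ℕ} (hx : x ∈ leadLE p) :
    prepend 1 x ∈ leadLE (p + 1) := by
  refine leadLE_induction (P := fun x => prepend 1 x ∈ leadLE (p + 1)) ?_ ?_ ?_ ?_ hx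
  · simp
  · intro x y hx hy; rw [map_add]; exact add_mem hx hy
  · intro c x hx; rw [map_smul]; exact Submodule.smul_mem _ _ hx
  · intro u hu; rw [word, prepend_word]; exact word_mem_leadLE (by simp [lead, hu])

/-- What remains of `z₁ ∗ z_u` after the words with the most leading ones are removed. -/
noncomputable def rest (u : Index) : Words :=
  stuffle (word [1]) (word u) - ((lead u : ℚ) + 1) • word (1 :: u)

lemma rest_mem (u : Index) : rest u ∈ leadLE (lead u) := by
  induction u with
  | nil => simp [rest, lead, stuffle_one_right]
  | cons k u ih =>
    have e1 : word (k :: u) = prepend k (word u) := by simp [word, prepend_word]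
    have e2 : word (1 :: k :: u) = prepend 1 (prepend k (word u)) := by simp [word, prepend_word]
    have e3 : word (1 :: u) = prepend 1 (word u) := by simp [word, prepend_word]
    have hk1 : k + 1 ≠ 1 := (PNat.lt_add_left 1 k).ne'
    by_cases hk : k = 1
    · subst hk
      have : rest (1 :: u) = prepend 1 (rest u) + prepend (1 + 1) (word u) := by
        simp only [rest, lead, e2, e1, stuffle_z_one_prepend, map_sub, map_smul, if_true]
        push_cast
        simp only [add_smul, one_smul]
        abel
      rw [this]
      have hl : lead (1 :: u) = lead u + 1 := by simp [lead]
      rw [hl]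
      exact add_mem (prepend_one_mem_leadLE ih) (prepend_mem_leadLE _ hk1 _ _)
    · have : rest (k :: u)
          = prepend k (stuffle (word [1]) (word u)) + prepend (k + 1) (word u) := by
        simp only [rest, lead, e1, e2, stuffle_z_one_prepend, if_neg hk]
        simp
        abel
      rw [this]
      exact add_mem (prepend_mem_leadLE _ hk _ _) (prepend_mem_leadLE _ hk1 _ _)

/-- The regularization on words with at most `p` leading ones. -/
noncomputable def regAux (V : ℝ) : ℕ → Words →ₗ[ℚ] ℝ
  | 0 => Finsupp.linearCombination ℚ t
  | p + 1 => Finsupp.linearCombination ℚ fun u =>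
      if lead u ≤ p then regAux V p (word u)
      else (V * regAux V p (word u.tail) - regAux V p (rest u.tail)) / ((p : ℝ) + 1)

noncomputable def regL (V : ℝ) : Words →ₗ[ℚ] ℝ :=
  Finsupp.linearCombination ℚ fun u => regAux V (lead u) (word u)

lemma regAux_word_succ (V : ℝ) (p : ℕ) (u : Index) (h : lead u ≤ p) :
    regAux V (p + 1) (word u) = regAux V p (word u) := by
  simp [regAux, h]

lemma regAux_word (V : ℝ) (p : ℕ) (u : Index) (h : lead u ≤ p) :
    regAux V p (word u) = regL V (word u) := by
  induction p, h using Nat.le_induction with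
  | base => simp [regL]
  | succ p hp ih => rw [regAux_word_succ V p u hp, ih]

lemma regAux_eq (V : ℝ) (p : ℕ) {x : Words} (hx : x ∈ leadLE p) : regAux V p x = regL V x := by
  refine leadLE_induction (P := fun x => regAux V p x = regL V x) ?_ ?_ ?_ ?_ hx
  · simp
  · intro x y hx hy; rw [map_add, map_add, hx, hy]
  · intro c x hx; rw [map_smul, map_smul, hx]
  · intro u hu; exact regAux_word V p u hu

lemma regL_cons_one (V : ℝ) (u : Index) :
    ((lead u : ℝ) + 1) * regL V (word (1 :: u)) = V * regL V (word u) - regL V (rest u) := by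
  have hl : lead (1 :: u) = lead u + 1 := by simp [lead]
  have h1 : regL V (word (1 :: u)) =
      (V * regAux V (lead u) (word u) - regAux V (lead u) (rest u)) / ((lead u : ℝ) + 1) := by
    rw [← regAux_word V (lead u + 1) (1 :: u) hl.le]
    simp [regAux, hl]
  rw [h1, regAux_word V _ u le_rfl, regAux_eq V _ (rest_mem u)]
  have : ((lead u : ℝ) + 1) ≠ 0 := by positivity
  field_simp

lemma regL_z_one_word (V : ℝ) (u : Index) :
    regL V (stuffle (word [1]) (word u)) = V * regL V (word u) := by
  have h : stuffle (word [1]) (word u) = ((lead u : ℚ) + 1) • word (1 :: u) + rest u := by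
    simp [rest]
  rw [h, map_add, map_smul, Rat.smul_def]
  push_cast
  rw [regL_cons_one]
  ring

lemma regL_z_one (V : ℝ) (x : Words) :
    regL V (stuffle (word [1]) x) = V * regL V x := by
  refine words_induction (P := fun x => regL V (stuffle (word [1]) x) = V * regL V x) ?_ ?_ ?_ ?_ x
  · simp
  · intro x y hx hy; simp only [map_add, hx, hy]; ring
  · intro c x hx; simp only [map_smul, hx, Rat.smul_def]; ring
  · exact regL_z_one_word V

lemma regL_mul_of_base (V : ℝ) (v : Index)
    (h0 : ∀ u, Admissible u → regL V (stuffle (word u) (word v))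
      = regL V (word u) * regL V (word v)) (u : Index) :
    regL V (stuffle (word u) (word v)) = regL V (word u) * regL V (word v) := by
  suffices H : ∀ p u, lead u ≤ p →
      regL V (stuffle (word u) (word v)) = regL V (word u) * regL V (word v) from H _ u le_rfl
  intro p
  induction p with
  | zero => intro u hu; exact h0 u ((lead_eq_zero_iff u).1 (Nat.le_zero.1 hu))
  | succ p ih =>
    intro u hu
    by_cases hp : lead u ≤ p
    · exact ih u hp
    match u, hu, hp with
    | [], hu, hp => simp [lead] at hp
    | k :: u, hu, hp =>
      by_cases hk : k = 1
      · subst hk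
        have hl : lead u = p := by simp [lead] at hu hp; omega
        have hrest : regL V (stuffle (rest u) (word v)) = regL V (rest u) * regL V (word v) := by
          have hm := rest_mem u
          rw [hl] at hm
          refine leadLE_induction (P := fun x => regL V (stuffle x (word v))
            = regL V x * regL V (word v)) ?_ ?_ ?_ ih hm
          · simp
          · intro x y hx hy; simp only [map_add, LinearMap.add_apply, hx, hy]; ring
          · intro c x hx; simp only [map_smul, LinearMap.smul_apply, hx, Rat.smul_def]; ring
        have hw : ((lead u : ℚ) + 1) • word (1 :: u) = stuffle (word [1]) (word u) - rest u := by
          simp [rest]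
        have e : ((lead u : ℝ) + 1) * regL V (stuffle (word (1 :: u)) (word v))
            = V * regL V (stuffle (word u) (word v)) - regL V (stuffle (rest u) (word v)) := by
          have := congrArg (fun x => regL V (stuffle x (word v))) hw
          simp only [map_smul, LinearMap.smul_apply, map_sub, LinearMap.sub_apply,
            Rat.smul_def, ← stuffle_z_one_assoc] at this
          push_cast at this
          rw [this, ← stuffle_word, regL_z_one]
        have hc : ((lead u : ℝ) + 1) ≠ 0 := by positivity
        apply mul_left_cancel₀ hc
        rw [e, hrest, ih u hl.le]
        linear_combination (-regL V (word v)) * regL_cons_one V u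
      · simp [lead, hk] at hp

/-- Truncated multiple `t`-values: the summation variables are less than `M`. -/
noncomputable def trunc : ℕ → Index → ℝ
  | _, [] => 1
  | 0, _ :: _ => 0
  | M + 1, k :: u => trunc M (k :: u) + (if Odd M then 1 / (M : ℝ) ^ (k : ℕ) else 0) * trunc M u

noncomputable def truncL (M : ℕ) : Words →ₗ[ℚ] ℝ := Finsupp.linearCombination ℚ (trunc M)

lemma truncL_word (M : ℕ) (u : Index) : truncL M (word u) = trunc M u := by simp [truncL]

lemma truncL_succ_prepend (M : ℕ) (k : ℕ+) (x : Words) :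
    truncL (M + 1) (prepend k x) = truncL M (prepend k x)
      + (if Odd M then 1 / (M : ℝ) ^ (k : ℕ) else 0) * truncL M x := by
  refine words_induction (P := fun x => truncL (M + 1) (prepend k x) = truncL M (prepend k x)
      + (if Odd M then 1 / (M : ℝ) ^ (k : ℕ) else 0) * truncL M x) ?_ ?_ ?_ ?_ x
  · simp
  · intro x y hx hy; simp only [map_add, hx, hy]; ring
  · intro c x hx; simp only [map_smul, hx, Rat.smul_def]; ring
  · intro u; rw [word, prepend_word]; simp only [truncL_word]; rw [trunc]

lemma truncL_zero_prepend (k : ℕ+) (x : Words) : truncL 0 (prepend k x) = 0 := by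
  refine words_induction (P := fun x => truncL 0 (prepend k x) = 0) ?_ ?_ ?_ ?_ x
  · simp
  · intro x y hx hy; simp only [map_add, hx, hy]; ring
  · intro c x hx; simp only [map_smul, hx, Rat.smul_def]; ring
  · intro u; rw [word, prepend_word]; simp only [truncL_word]; rw [trunc]

lemma truncL_stuffleWord (M : ℕ) (u v : Index) :
    truncL M (stuffleWord u v) = trunc M u * trunc M v := by
  induction M generalizing u v with
  | zero =>
    match u, v with
    | [], v => rw [stuffleWord, truncL_word, trunc]; ring
    | k :: u, [] => rw [stuffleWord, truncL_word]; simp [trunc]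
    | k :: u, l :: v =>
      rw [stuffleWord]
      simp only [map_add, truncL_zero_prepend]
      simp [trunc]
  | succ M ih =>
    match u, v with
    | [], v => rw [stuffleWord, truncL_word]; simp [trunc]
    | k :: u, [] => rw [stuffleWord, truncL_word]; simp [trunc]
    | k :: u, l :: v =>
      have h := ih (k :: u) (l :: v)
      rw [stuffleWord] at h ⊢
      simp only [map_add] at h ⊢
      simp only [truncL_succ_prepend, ih, trunc]
      split_ifs with hM
      · have hM0 : (M : ℝ) ≠ 0 := by
          have := hM.pos; positivity
        rw [PNat.add_coe, pow_add]
        rw [one_div_mul_eq_div, one_div_mul_eq_div, one_div_mul_eq_div, one_div_mul_eq_div,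
          one_div_mul_eq_div]
        field_simp
        field_simp at h
        linear_combination ((M : ℝ) ^ (k : ℕ) * (M : ℝ) ^ (l : ℕ)) * h
      · simp only [zero_mul, add_zero]; exact h

/-- Strictly decreasing odd tuples with entries less than `M`. -/
noncomputable def tuples (M n : ℕ) : Finset (Fin n → ℕ) := by
  classical
  exact (Fintype.piFinset fun _ => Finset.range M).filter
    fun m => StrictAnti m ∧ ∀ i, Odd (m i)

lemma mem_tuples {M n : ℕ} {m : Fin n → ℕ} :
    m ∈ tuples M n ↔ (∀ i, m i < M) ∧ StrictAnti m ∧ ∀ i, Odd (m i) := by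
  simp [tuples]

lemma strictAnti_cons {n : ℕ} {M : ℕ} {m : Fin n → ℕ} :
    StrictAnti (Fin.cons M m : Fin (n + 1) → ℕ) ↔ (∀ i, m i < M) ∧ StrictAnti m := by
  constructor
  · intro h
    refine ⟨fun i => ?_, fun i j hij => ?_⟩
    · simpa using h (Fin.succ_pos i)
    · simpa using h (Fin.succ_lt_succ_iff.2 hij)
  · rintro ⟨h1, h2⟩ i j hij
    induction i using Fin.cases with
    | zero =>
      induction j using Fin.cases with
      | zero => exact absurd hij (lt_irrefl _)
      | succ j => simpa using h1 j
    | succ i =>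
      induction j using Fin.cases with
      | zero => exact absurd hij (Fin.not_lt_zero _)
      | succ j => simpa using h2 (Fin.succ_lt_succ_iff.1 hij)

lemma sum_tuples_succ (M n : ℕ) (f : (Fin (n + 1) → ℕ) → ℝ) :
    ∑ m ∈ tuples (M + 1) (n + 1), f m = ∑ m ∈ tuples M (n + 1), f m
      + if Odd M then ∑ m ∈ tuples M n, f (Fin.cons M m) else 0 := by
  classical
  have hinj : Function.Injective (fun m : Fin n → ℕ => (Fin.cons M m : Fin (n + 1) → ℕ)) :=
    fun a b h => Fin.cons_right_injective _ h
  rw [← Finset.sum_filter_add_sum_filter_not (tuples (M + 1) (n + 1)) (fun m => m 0 < M)]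
  congr 1
  · apply Finset.sum_congr _ (fun _ _ => rfl)
    ext m
    simp only [Finset.mem_filter, mem_tuples]
    constructor
    · rintro ⟨⟨_, h2, h3⟩, h4⟩
      exact ⟨fun i => lt_of_le_of_lt (h2.antitone (Fin.zero_le i)) h4, h2, h3⟩
    · rintro ⟨h1, h2, h3⟩
      exact ⟨⟨fun i => (h1 i).trans (Nat.lt_succ_self M), h2, h3⟩, h1 0⟩
  · split_ifs with hM
    · rw [← Finset.sum_image (f := f) (g := fun m : Fin n → ℕ => (Fin.cons M m : Fin (n + 1) → ℕ))
        (fun a _ b _ h => hinj h)]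
      apply Finset.sum_congr _ (fun _ _ => rfl)
      ext m
      simp only [Finset.mem_filter, mem_tuples, Finset.mem_image]
      constructor
      · rintro ⟨⟨h1, h2, h3⟩, h4⟩
        have h0 : m 0 = M := le_antisymm (Nat.lt_succ_iff.1 (h1 0)) (not_lt.1 h4)
        have hm : (Fin.cons M (Fin.tail m) : Fin (n + 1) → ℕ) = m := by
          rw [← h0]; exact Fin.cons_self_tail m
        refine ⟨Fin.tail m, ?_, hm⟩
        rw [← hm, strictAnti_cons] at h2
        exact ⟨h2.1, h2.2, fun i => h3 i.succ⟩
      · rintro ⟨m, ⟨h1, h2, h3⟩, rfl⟩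
        refine ⟨⟨fun i => ?_, strictAnti_cons.2 ⟨h1, h2⟩, fun i => ?_⟩, by simp⟩
        · induction i using Fin.cases with
          | zero => simp
          | succ i => simpa using (h1 i).trans (Nat.lt_succ_self M)
        · induction i using Fin.cases with
          | zero => simpa using hM
          | succ i => simpa using h3 i
    · apply Finset.sum_eq_zero
      intro m hm
      simp only [Finset.mem_filter, mem_tuples] at hm
      obtain ⟨⟨h1, h2, h3⟩, h4⟩ := hm
      have h0 : m 0 = M := le_antisymm (Nat.lt_succ_iff.1 (h1 0)) (not_lt.1 h4)
      exact absurd (h0 ▸ h3 0) hM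

lemma trunc_eq_sum (M : ℕ) (u : Index) :
    trunc M u = ∑ m ∈ tuples M u.length, ∏ i, 1 / (m i : ℝ) ^ (u.get i : ℕ) := by
  induction M generalizing u with
  | zero =>
    cases u with
    | nil =>
      have : tuples 0 0 = Finset.univ := by
        ext m; simp [mem_tuples, StrictAnti, eq_iff_true_of_subsingleton]
      simp [trunc, this]
    | cons k u =>
      rw [trunc, Finset.sum_eq_zero]
      intro m hm
      exact absurd ((mem_tuples.1 hm).1 ⟨0, by simp⟩) (Nat.not_lt_zero _)
  | succ M ih =>
    cases u with
    | nil =>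
      have : tuples (M + 1) 0 = Finset.univ := by
        ext m; simp [mem_tuples, StrictAnti, eq_iff_true_of_subsingleton]
      simp [trunc, this]
    | cons k u =>
      rw [trunc, ih, ih]
      have := sum_tuples_succ M u.length
        (fun m => ∏ i, 1 / (m i : ℝ) ^ (((k :: u).get i : ℕ+) : ℕ))
      refine Eq.trans ?_ this.symm
      congr 1
      split_ifs with hM
      · rw [Finset.mul_sum]
        apply Finset.sum_congr rfl
        intro m _
        rw [Fin.prod_univ_succ]
        simp
      · simp

lemma trunc_nonneg (M : ℕ) (u : Index) : 0 ≤ trunc M u := by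
  rw [trunc_eq_sum]; positivity

lemma trunc_le_sqrt (M : ℕ) (hM : 1 ≤ M) (u : Index) :
    trunc M u ≤ 3 ^ u.length * Real.sqrt M := by
  induction u generalizing M with
  | nil =>
    simp only [trunc, List.length_nil, pow_zero, one_mul]
    rw [Real.one_le_sqrt]; exact_mod_cast hM
  | cons k u ihu =>
    have key : ∀ N : ℕ, trunc N (k :: u) ≤ 3 ^ (k :: u).length * Real.sqrt N := by
      intro N
      induction N with
      | zero => simp [trunc]
      | succ N ih =>
        rw [trunc]
        split_ifs with hN
        · have hN1 : 1 ≤ N := hN.pos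
          have hNr : (1 : ℝ) ≤ N := by exact_mod_cast hN1
          have hs : 0 < Real.sqrt N := Real.sqrt_pos.2 (by linarith)
          have h1 : 1 / (N : ℝ) ^ (k : ℕ) ≤ 1 / N := by
            apply one_div_le_one_div_of_le (by linarith)
            exact le_self_pow₀ hNr k.ne_zero
          have h2 := ihu N hN1
          have hsq : Real.sqrt N * Real.sqrt N = N := Real.mul_self_sqrt (by linarith)
          have h3 : 1 / (N : ℝ) ^ (k : ℕ) * trunc N u ≤ 3 ^ u.length * (1 / Real.sqrt N) := by
            calc 1 / (N : ℝ) ^ (k : ℕ) * trunc N u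
                ≤ 1 / N * (3 ^ u.length * Real.sqrt N) :=
                  mul_le_mul h1 h2 (trunc_nonneg _ _) (by positivity)
              _ = 3 ^ u.length * (1 / Real.sqrt N) := by
                  nth_rewrite 1 [← hsq]
                  field_simp
          have h4 : 1 / Real.sqrt N ≤ 3 * (Real.sqrt ((N + 1 : ℕ) : ℝ) - Real.sqrt N) := by
            have hs' : Real.sqrt ((N + 1 : ℕ) : ℝ) * Real.sqrt ((N + 1 : ℕ) : ℝ) = N + 1 := by
              rw [Real.mul_self_sqrt (by positivity)]; push_cast; ring
            set s := Real.sqrt N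
            set r := Real.sqrt ((N + 1 : ℕ) : ℝ)
            have hr : 0 ≤ r := Real.sqrt_nonneg _
            have hr2 : r ≤ 2 * s := by nlinarith
            have hrs : s ≤ r := Real.sqrt_le_sqrt (by push_cast; linarith)
            rw [div_le_iff₀ hs]
            nlinarith
          have h5 : (3 : ℝ) ^ u.length * (1 / Real.sqrt N)
              ≤ 3 ^ u.length * (3 * (Real.sqrt ((N + 1 : ℕ) : ℝ) - Real.sqrt N)) :=
            mul_le_mul_of_nonneg_left h4 (by positivity)
          rw [List.length_cons, pow_succ] at ih ⊢
          linarith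
        · rw [zero_mul, add_zero]
          refine ih.trans (mul_le_mul_of_nonneg_left (Real.sqrt_le_sqrt ?_) (by positivity))
          push_cast; linarith
    exact key M

lemma trunc_bounded (u : Index) (hu : Admissible u) : ∃ C, ∀ M, trunc M u ≤ C := by
  cases u with
  | nil => exact ⟨1, fun M => by simp [trunc]⟩
  | cons k u =>
    have hk : 2 ≤ (k : ℕ) := by
      have : (1 : ℕ+) < k := hu
      exact_mod_cast this
    have hsum : Summable fun n : ℕ => (3 : ℝ) ^ u.length * ((n : ℝ) ^ (3 / 2 : ℝ))⁻¹ :=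
      (Real.summable_nat_rpow_inv.2 (by norm_num)).mul_left _
    refine ⟨∑' n : ℕ, (3 : ℝ) ^ u.length * ((n : ℝ) ^ (3 / 2 : ℝ))⁻¹, fun M => ?_⟩
    refine le_trans ?_ (hsum.sum_le_tsum (Finset.range M) (fun i _ => by positivity))
    induction M with
    | zero => simp [trunc]
    | succ M ih =>
      rw [trunc, Finset.sum_range_succ]
      refine add_le_add ih ?_
      split_ifs with hM
      · have hM1 : 1 ≤ M := hM.pos
        have hMr : (1 : ℝ) ≤ M := by exact_mod_cast hM1
        have h2 := trunc_le_sqrt M hM1 u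
        have h1 : 1 / (M : ℝ) ^ (k : ℕ) ≤ 1 / (M : ℝ) ^ 2 :=
          one_div_le_one_div_of_le (by positivity) (pow_le_pow_right₀ hMr hk)
        calc 1 / (M : ℝ) ^ (k : ℕ) * trunc M u
            ≤ 1 / (M : ℝ) ^ 2 * (3 ^ u.length * Real.sqrt M) :=
              mul_le_mul h1 h2 (trunc_nonneg _ _) (by positivity)
          _ = 3 ^ u.length * ((M : ℝ) ^ (3 / 2 : ℝ))⁻¹ := by
              have h0 : (0 : ℝ) < M := by linarith
              have e : (M : ℝ) ^ 2 = (M : ℝ) ^ (3 / 2 : ℝ) * Real.sqrt M := by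
                rw [Real.sqrt_eq_rpow, ← Real.rpow_add h0, ← Real.rpow_natCast]
                norm_num
              have hs : 0 < Real.sqrt M := Real.sqrt_pos.2 h0
              rw [e]
              field_simp
      · rw [zero_mul]; positivity

lemma tendsto_trunc (u : Index) (hu : Admissible u) :
    Filter.Tendsto (fun M => trunc M u) Filter.atTop (nhds (t u)) := by
  classical
  obtain ⟨C, hC⟩ := trunc_bounded u hu
  let s : Set (Fin u.length → ℕ) := {m | StrictAnti m ∧ ∀ i, Odd (m i)}
  let f : (Fin u.length → ℕ) → ℝ := fun m => ∏ i, 1 / (m i : ℝ) ^ (u.get i : ℕ)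
  have hf : ∀ m, 0 ≤ f m := fun m => by positivity
  have hsub : ∀ m : s, ∃ M, m.1 ∈ tuples M u.length := by
    intro m
    obtain ⟨M, hM⟩ := (Set.finite_range m.1).bddAbove
    exact ⟨M + 1, mem_tuples.2 ⟨fun i => Nat.lt_succ_of_le (hM ⟨i, rfl⟩), m.2⟩⟩
  let A : ℕ → Finset s := fun M => (tuples M u.length).subtype (· ∈ s)
  have hA : Monotone A := by
    intro M N h m hm
    simp only [A, Finset.mem_subtype, mem_tuples] at hm ⊢
    exact ⟨fun i => (hm.1 i).trans_le h, hm.2⟩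
  have hex : ∀ m : s, ∃ M, m ∈ A M := by
    intro m
    obtain ⟨M, hM⟩ := hsub m
    exact ⟨M, by simpa [A] using hM⟩
  have htend := Filter.tendsto_atTop_finset_of_monotone hA hex
  have hval : ∀ M, ∑ m ∈ A M, f m.1 = trunc M u := by
    intro M
    rw [trunc_eq_sum]
    exact Finset.sum_subtype_of_mem f (fun m hm => (mem_tuples.1 hm).2)
  have hsumm : Summable fun m : s => f m.1 := by
    refine summable_of_sum_le (c := C) (fun m => hf m.1) fun B => ?_
    obtain ⟨M, hM⟩ := (htend.eventually (Filter.eventually_ge_atTop B)).exists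
    calc ∑ m ∈ B, f m.1 ≤ ∑ m ∈ A M, f m.1 :=
          Finset.sum_le_sum_of_subset_of_nonneg hM (fun m _ _ => hf m.1)
      _ = trunc M u := hval M
      _ ≤ C := hC M
  have := hsumm.hasSum.comp htend
  refine Filter.Tendsto.congr (fun M => hval M) ?_
  exact this

lemma tendsto_truncL (V : ℝ) {x : Words} (hx : x ∈ leadLE 0) :
    Filter.Tendsto (fun M => truncL M x) Filter.atTop (nhds (regL V x)) := by
  refine leadLE_induction (P := fun x => Filter.Tendsto (fun M => truncL M x) Filter.atTop
    (nhds (regL V x))) ?_ ?_ ?_ ?_ hx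
  · simp
  · intro x y hx hy; simpa using hx.add hy
  · intro c x hx; simpa [Rat.smul_def] using hx.const_mul (c : ℝ)
  · intro u hu
    have ha := (lead_eq_zero_iff u).1 (Nat.le_zero.1 hu)
    have e : regL V (word u) = t u := by
      rw [← regAux_word V 0 u hu]; simp [regAux]
    rw [e]
    simpa [truncL_word] using tendsto_trunc u ha

lemma stuffleWord_mem (u v : Index) (hu : Admissible u) (hv : Admissible v) :
    stuffleWord u v ∈ leadLE 0 := by
  match u, v with
  | [], v => rw [stuffleWord]; exact word_mem_leadLE ((lead_eq_zero_iff v).2 hv).le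
  | k :: u, [] => rw [stuffleWord]; exact word_mem_leadLE ((lead_eq_zero_iff _).2 hu).le
  | k :: u, l :: v =>
    rw [stuffleWord]
    have hk : (1 : ℕ+) < k := hu
    have hl : (1 : ℕ+) < l := hv
    refine add_mem (add_mem ?_ ?_) ?_
    · exact prepend_mem_leadLE _ hk.ne' _ _
    · exact prepend_mem_leadLE _ hl.ne' _ _
    · exact prepend_mem_leadLE _ (hk.trans (PNat.lt_add_right k l)).ne' _ _

lemma regL_mul_word (V : ℝ) (u v : Index) :
    regL V (stuffle (word u) (word v)) = regL V (word u) * regL V (word v) := by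
  have base : ∀ u v, Admissible u → Admissible v →
      regL V (stuffle (word u) (word v)) = regL V (word u) * regL V (word v) := by
    intro u v hu hv
    rw [stuffle_word]
    have h1 := tendsto_truncL V (stuffleWord_mem u v hu hv)
    have h2 := (tendsto_truncL V (word_mem_leadLE ((lead_eq_zero_iff u).2 hu).le)).mul
      (tendsto_truncL V (word_mem_leadLE ((lead_eq_zero_iff v).2 hv).le))
    refine tendsto_nhds_unique h1 (h2.congr fun M => ?_)
    rw [truncL_stuffleWord, truncL_word, truncL_word]
  refine regL_mul_of_base V v (fun w hw => ?_) u
  rw [stuffle_comm, mul_comm]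
  exact regL_mul_of_base V w (fun w' hw' => base w' w hw' hw) v

lemma regL_spec (V : ℝ) : IsStuffleRegularization V (regL V) where
  map_stuffle u v := by
    refine words_induction (P := fun u => regL V (stuffle u v) = regL V u * regL V v) ?_ ?_ ?_ ?_ u
    · simp
    · intro x y hx hy; simp only [map_add, LinearMap.add_apply, hx, hy]; ring
    · intro c x hx; simp only [map_smul, LinearMap.smul_apply, hx, Rat.smul_def]; ring
    · intro u
      refine words_induction (P := fun v => regL V (stuffle (word u) v)
        = regL V (word u) * regL V v) ?_ ?_ ?_ ?_ v
      · simp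
      · intro x y hx hy; simp only [map_add, hx, hy]; ring
      · intro c x hx; simp only [map_smul, hx, Rat.smul_def]; ring
      · exact regL_mul_word V u
  map_admissible k hk := by
    rw [← regAux_word V 0 k ((lead_eq_zero_iff k).2 hk).le]; simp [regAux]
  map_z_one := by
    have h := regL_z_one_word V []
    rw [stuffle_one_right] at h
    rw [h, ← regAux_word V 0 [] le_rfl]
    simp [regAux, t, StrictAnti]

theorem existsUnique_stuffleRegularization (V : ℝ) :
    ∃! φ : Words →ₗ[ℚ] ℝ, IsStuffleRegularization V φ := by
  refine ⟨regL V, regL_spec V, fun ψ hψ => ?_⟩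
  have H : ∀ p u, lead u ≤ p → ψ (word u) = regL V (word u) := by
    intro p
    induction p with
    | zero =>
      intro u hu
      have ha := (lead_eq_zero_iff u).1 (Nat.le_zero.1 hu)
      rw [hψ.map_admissible u ha, (regL_spec V).map_admissible u ha]
    | succ p ih =>
      intro u hu
      by_cases hp : lead u ≤ p
      · exact ih u hp
      match u, hu, hp with
      | [], hu, hp => simp [lead] at hp
      | k :: u, hu, hp =>
        by_cases hk : k = 1
        · subst hk
          have hl : lead u = p := by simp [lead] at hu hp; omega
          have hrest : ψ (rest u) = regL V (rest u) := by
            have hm := rest_mem u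
            rw [hl] at hm
            refine leadLE_induction (P := fun x => ψ x = regL V x) ?_ ?_ ?_ ih hm
            · simp
            · intro x y hx hy; simp only [map_add, hx, hy]
            · intro c x hx; simp only [map_smul, hx]
          have hw : ((lead u : ℚ) + 1) • word (1 :: u)
              = stuffle (word [1]) (word u) - rest u := by
            simp [rest]
          have h1 := congrArg ψ hw
          have h2 := congrArg (regL V) hw
          rw [map_smul, map_sub, hψ.map_stuffle, hψ.map_z_one, hrest, ih u hl.le] at h1
          rw [map_smul, map_sub, (regL_spec V).map_stuffle, (regL_spec V).map_z_one, ← h1] at h2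
          have hc : ((lead u : ℚ) + 1) ≠ 0 := by positivity
          exact (smul_right_injective ℝ hc h2).symm
        · simp [lead, hk] at hp
  refine LinearMap.ext fun x => ?_
  refine words_induction (P := fun x => ψ x = regL V x) ?_ ?_ ?_ ?_ x
  · simp
  · intro x y hx hy; simp only [map_add, hx, hy]
  · intro c x hx; simp only [map_smul, hx]
  · intro u; exact H _ u le_rfl

/-! ### The regularizations -/

/-- The stuffle regularization `t_∗^V : 𝔄¹ → ℝ`. -/
noncomputable def tReg (V : ℝ) : Words →ₗ[ℚ] ℝ := (existsUnique_stuffleRegularization V).choose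

theorem tReg_spec (V : ℝ) : IsStuffleRegularization V (tReg V) :=
  (existsUnique_stuffleRegularization V).choose_spec.1

/-- Replace the first letter `z_l` of every word by `z_{k + l}`, that is, concatenate with
`x ^ k` on the left. Only used on combinations of nonempty words. -/
noncomputable def addHead (k : ℕ+) : Words →ₗ[ℚ] Words :=
  Finsupp.lmapDomain ℚ ℚ fun u : Index => match u with
    | [] => []
    | l :: v => (k + l) :: v

/-- The map `S` on words: `S(1) = 1` and `S(w y) = γ(w) y`, where the automorphism `γ` of
`ℚ⟨x, y⟩` fixes `x` and sends `y` to `x + y`; in terms of the letters `z_k` this reads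
`S(z_k z_l w) = z_k S(z_l w) + x ^ k S(z_l w)`, since
`γ(x ^ (k - 1) y) = x ^ (k - 1) y + x ^ k = z_k + x ^ k`. -/
noncomputable def starWord : Index → Words
  | [] => word []
  | [k] => word [k]
  | k :: l :: u => prepend k (starWord (l :: u)) + addHead k (starWord (l :: u))

/-- The linear map `S : 𝔄¹ → 𝔄¹`. -/
noncomputable def starMap : Words →ₗ[ℚ] Words := Finsupp.linearCombination ℚ starWord

/-- The star-stuffle regularization map `t^{⋆,V} = t_∗^V ∘ S` on `𝔄¹`. -/
noncomputable def tStarRegMap (V : ℝ) : Words →ₗ[ℚ] ℝ := tReg V ∘ₗ starMap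

/-- The star-stuffle regularized value `t^{⋆,V}(k₁, …, kₙ)` of an index. -/
noncomputable def tStarReg (V : ℝ) (k : Index) : ℝ := tStarRegMap V (word k)

end MultipleT

/-!
The truncation of `t⋆(k)` to odd summation variables below `M` is the truncation of `t` at `S(k)`
(`truncL_starWord`). If `k₁ ≠ 1` the regularized value is therefore the limit of the truncated star
sums, and for an index `(1, k₂, …)` with `k₂ ≠ 1` it is the limit after subtraction of
`(∑ 1 / m - V)` times the truncated sum of `(k₂, …)` (`tendsto_starTrunc_one_cons`).

Let `dₙ` be the polynomials with `d₀ = 1`, `dₙ₊₁'' = -dₙ`, `dₙ₊₁'(0) = 0`, `dₙ₊₁(π / 2) = 0`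
(`greenPoly`). Three facts turn the truncated sums of `({2}ᵃ, 1, {2}ᵇ)` into integrals.

* The inner sums are moments: for odd `m`, the star sum of `{2}ᵇ` over variables at most `m` is, up
  to the Wallis factor, `∫ cos x ^ m dᵦ(x)` over `[0, π / 2]`, by two integrations by parts
  (`integral_cos_pow_mul_greenPoly`).
* The outer sums are coefficients: the trigonometric sums `cos x · tailSum a N (sin x)`, whose
  coefficients are Wallis numbers times star sums of `{2}ᵃ` over variables at least `m`, satisfy the
  recursive differential equation of the `dₐ`, and for `a = 0` they tend to `1`. Hence they tend to
  `dₐ`, with an explicit error (`negSecondDeriv_tailSum`, `greenError_bounds`). In particular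
  `dₙ(0) = t⋆({2}ⁿ)` (`tStar_two`).
* Substituting `π / 2 - x` for `x` in the latter and integrating, the limit is
  `∫ dᵦ(x) dₐ(π / 2 - x) cot x` over `[0, π / 2]`, with `dᵦ(x)` replaced by `dᵦ(x) - dᵦ(0)` and
  `V dᵦ(0)` added if `a = 0` (`tStarReg_two_succ_eq_integral`,
  `tStarReg_one_two_eq_integral`).

For a polynomial `f` with `f(0) = 0`, the integral of `f(x) cot x` is a combination of `log 2` and
the values `ζ(2 r + 1)` with coefficients given by the derivatives `f^(2 r)` at `0` and `π / 2`:
this is integration by parts in the expansion `cot x = 2 ∑ sin (2 n x)`, whose partial sums are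
controlled by the Riemann–Lebesgue lemma (`integral_mulCot`). For `f = dᵦ(x) dₐ(π / 2 - x)` a single
term of the Leibniz formula survives at each end point, which produces the two binomial coefficients
(`eval_zero_iterate_derivative_greenProd`).
-/

namespace MultipleT

/-! ### Truncated star sums and the regularization -/

/-- The truncation of `t⋆`: the summation variables `m₁ ≥ ⋯ ≥ mₙ` are odd and less than `M`. -/
noncomputable def starTrunc : ℕ → Index → ℝ
  | _, [] => 1
  | 0, _ :: _ => 0
  | M + 1, k :: u =>
      starTrunc M (k :: u) + (if Odd M then 1 / (M : ℝ) ^ (k : ℕ) else 0) * starTrunc (M + 1) u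

/-- The combinations of nonempty words. -/
noncomputable def nonemptyWords : Submodule ℚ Words := Finsupp.supported ℚ ℚ {u | u ≠ []}

lemma nonemptyWords_induction {P : Words → Prop} (h0 : P 0)
    (ha : ∀ x y, P x → P y → P (x + y)) (hs : ∀ (c : ℚ) x, P x → P (c • x))
    (hw : ∀ l v, P (word (l :: v))) {x : Words} (hx : x ∈ nonemptyWords) : P x := by
  rw [nonemptyWords, Finsupp.supported_eq_span_single] at hx
  induction hx using Submodule.span_induction with
  | mem x h =>
    obtain ⟨u, hu, rfl⟩ := h
    cases u with
    | nil => exact absurd rfl hu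
    | cons l v => exact hw l v
  | zero => exact h0
  | add x y _ _ hx hy => exact ha _ _ hx hy
  | smul c x _ hx => exact hs _ _ hx

lemma addHead_word_cons (k l : ℕ+) (v : Index) :
    addHead k (word (l :: v)) = word ((k + l) :: v) := by
  simp [addHead, Finsupp.lmapDomain_apply, Finsupp.mapDomain_single, word]

lemma prepend_mem_nonemptyWords (k : ℕ+) (x : Words) : prepend k x ∈ nonemptyWords := by
  refine words_induction (P := fun x => prepend k x ∈ nonemptyWords) ?_ ?_ ?_ ?_ x
  · simp
  · intro x y hx hy; rw [map_add]; exact add_mem hx hy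
  · intro c x hx; rw [map_smul]; exact Submodule.smul_mem _ _ hx
  · intro u; rw [word, prepend_word]; exact Finsupp.single_mem_supported ℚ _ (by simp)

lemma addHead_mem_nonemptyWords (k : ℕ+) {x : Words} (hx : x ∈ nonemptyWords) :
    addHead k x ∈ nonemptyWords := by
  refine nonemptyWords_induction (P := fun x => addHead k x ∈ nonemptyWords) ?_ ?_ ?_ ?_ hx
  · simp
  · intro x y hx hy; rw [map_add]; exact add_mem hx hy
  · intro c x hx; rw [map_smul]; exact Submodule.smul_mem _ _ hx
  · intro l v; rw [addHead_word_cons]; exact Finsupp.single_mem_supported ℚ _ (by simp)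

lemma starWord_mem_nonemptyWords (k : ℕ+) (u : Index) : starWord (k :: u) ∈ nonemptyWords := by
  induction u generalizing k with
  | nil => rw [starWord]; exact Finsupp.single_mem_supported ℚ _ (by simp)
  | cons l v ih =>
    rw [starWord]
    exact add_mem (prepend_mem_nonemptyWords _ _) (addHead_mem_nonemptyWords _ (ih l))

/-- Merging the letter `z_k` into the first letter turns the increments in `M` of a truncated value
into `M ^ (-k)` times these increments. -/
lemma truncL_succ_addHead (M : ℕ) (k : ℕ+) {x : Words} (hx : x ∈ nonemptyWords) :
    truncL (M + 1) (addHead k x) = truncL M (addHead k x)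
      + (if Odd M then 1 / (M : ℝ) ^ (k : ℕ) else 0) * (truncL (M + 1) x - truncL M x) := by
  refine nonemptyWords_induction (P := fun x => truncL (M + 1) (addHead k x)
      = truncL M (addHead k x)
      + (if Odd M then 1 / (M : ℝ) ^ (k : ℕ) else 0) * (truncL (M + 1) x - truncL M x))
      ?_ ?_ ?_ ?_ hx
  · simp
  · intro x y hx hy; simp only [map_add, hx, hy]; ring
  · intro c x hx; simp only [map_smul, hx, Rat.smul_def]; ring
  · intro l v
    rw [addHead_word_cons]
    simp only [truncL_word]
    rw [trunc, trunc]
    split_ifs with hM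
    · rw [PNat.add_coe, pow_add]
      have : (M : ℝ) ≠ 0 := by have := hM.pos; positivity
      field_simp
      ring
    · ring

lemma truncL_zero_of_nonempty {x : Words} (hx : x ∈ nonemptyWords) : truncL 0 x = 0 := by
  refine nonemptyWords_induction (P := fun x => truncL 0 x = 0) ?_ ?_ ?_ ?_ hx
  · simp
  · intro x y hx hy; simp only [map_add, hx, hy, add_zero]
  · intro c x hx; simp only [map_smul, hx, smul_zero]
  · intro l v; rw [truncL_word, trunc]

/-- The map `S` turns truncated `t`-values into truncated `t⋆`-values. -/
lemma truncL_starWord (M : ℕ) (u : Index) : truncL M (starWord u) = starTrunc M u := by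
  induction u generalizing M with
  | nil => rw [starWord, truncL_word]; simp [trunc, starTrunc]
  | cons k u ihu =>
    induction M with
    | zero => rw [truncL_zero_of_nonempty (starWord_mem_nonemptyWords k u), starTrunc]
    | succ M ih =>
      rw [starTrunc, ← ih, ← ihu]
      cases u with
      | nil => simp only [starWord, truncL_word]; rw [trunc]; simp [trunc]
      | cons l v =>
        simp only [starWord, map_add]
        rw [truncL_succ_prepend, truncL_succ_addHead M k (starWord_mem_nonemptyWords l v)]
        ring

lemma addHead_mem_leadLE (k : ℕ+) {x : Words} (hx : x ∈ nonemptyWords) :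
    addHead k x ∈ leadLE 0 := by
  refine nonemptyWords_induction (P := fun x => addHead k x ∈ leadLE 0) ?_ ?_ ?_ ?_ hx
  · simp
  · intro x y hx hy; rw [map_add]; exact add_mem hx hy
  · intro c x hx; rw [map_smul]; exact Submodule.smul_mem _ _ hx
  · intro l v
    rw [addHead_word_cons]
    refine word_mem_leadLE ?_
    have : k + l ≠ 1 := ((one_le : 1 ≤ k).trans_lt (PNat.lt_add_right k l)).ne'
    simp [lead, this]

lemma starWord_mem_leadLE (k : ℕ+) (hk : k ≠ 1) (u : Index) : starWord (k :: u) ∈ leadLE 0 := by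
  cases u with
  | nil => rw [starWord]; exact word_mem_leadLE (by simp [lead, hk])
  | cons l v =>
    rw [starWord]
    exact add_mem (prepend_mem_leadLE k hk _ 0)
      (addHead_mem_leadLE k (starWord_mem_nonemptyWords l v))

lemma tReg_eq_regL (V : ℝ) : tReg V = regL V :=
  (existsUnique_stuffleRegularization V).unique (tReg_spec V) (regL_spec V)

lemma tStarReg_eq (V : ℝ) (k : Index) : tStarReg V k = regL V (starWord k) := by
  simp [tStarReg, tStarRegMap, starMap, tReg_eq_regL, word]

/-- A star-stuffle regularized value whose index does not start with `1` is the convergent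
limit. -/
lemma tendsto_starTrunc_tStarReg (V : ℝ) (k : ℕ+) (hk : k ≠ 1) (u : Index) :
    Filter.Tendsto (fun M => starTrunc M (k :: u)) Filter.atTop (nhds (tStarReg V (k :: u))) := by
  rw [tStarReg_eq]
  simpa only [truncL_starWord] using tendsto_truncL V (starWord_mem_leadLE k hk u)

lemma truncL_stuffle (M : ℕ) (x y : Words) :
    truncL M (stuffle x y) = truncL M x * truncL M y := by
  refine words_induction (P := fun x => truncL M (stuffle x y) = truncL M x * truncL M y)
    ?_ ?_ ?_ ?_ x
  · simp
  · intro x x' hx hx'; simp only [map_add, LinearMap.add_apply, hx, hx']; ring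
  · intro c x hx; simp only [map_smul, LinearMap.smul_apply, hx, Rat.smul_def]; ring
  · intro u
    refine words_induction (P := fun y => truncL M (stuffle (word u) y)
      = truncL M (word u) * truncL M y) ?_ ?_ ?_ ?_ y
    · simp
    · intro x x' hx hx'; simp only [map_add, hx, hx']; ring
    · intro c x hx; simp only [map_smul, hx, Rat.smul_def]; ring
    · intro v; rw [stuffle_word, truncL_stuffleWord, truncL_word, truncL_word]

lemma stuffle_z_one_sub_prepend_mem {x : Words} (hx : x ∈ leadLE 0) :
    stuffle (word [1]) x - prepend 1 x ∈ leadLE 0 := by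
  refine leadLE_induction (P := fun x => stuffle (word [1]) x - prepend 1 x ∈ leadLE 0)
    ?_ ?_ ?_ ?_ hx
  · simp
  · intro x y hx hy
    have := add_mem hx hy
    simp only [map_add]
    convert this using 1
    abel
  · intro c x hx
    have := Submodule.smul_mem _ c hx
    simp only [map_smul]
    rwa [smul_sub] at this
  · intro u hu
    have h := rest_mem u
    have h0 : lead u = 0 := Nat.le_zero.1 hu
    rw [h0] at h
    simpa [rest, h0, prepend_word, word] using h

/-- The regularized value of an index with exactly one leading `1`: the divergence of the truncated
sums is cancelled by the truncation of `t(1) - V`. -/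
lemma tendsto_starTrunc_one_cons (V : ℝ) (k : ℕ+) (hk : k ≠ 1) (u : Index) :
    Filter.Tendsto
      (fun M => starTrunc M (1 :: k :: u) - (starTrunc M [1] - V) * starTrunc M (k :: u))
      Filter.atTop (nhds (tStarReg V (1 :: k :: u))) := by
  set x := starWord (k :: u) with hx
  have hx0 : x ∈ leadLE 0 := starWord_mem_leadLE k hk u
  set r := addHead 1 x - (stuffle (word [1]) x - prepend 1 x) with hr
  have hr0 : r ∈ leadLE 0 :=
    sub_mem (addHead_mem_leadLE 1 (starWord_mem_nonemptyWords k u))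
      (stuffle_z_one_sub_prepend_mem hx0)
  have hS : starWord (1 :: k :: u) = stuffle (word [1]) x + r := by
    rw [starWord, ← hx, hr]; abel
  rw [tStarReg_eq, hS, map_add, regL_z_one]
  refine (((tendsto_truncL V hx0).const_mul V).add (tendsto_truncL V hr0)).congr fun M => ?_
  have h1 : truncL M r = starTrunc M (1 :: k :: u) - starTrunc M [1] * truncL M x := by
    rw [← truncL_starWord M (1 :: k :: u), hS, map_add, truncL_stuffle,
      ← truncL_starWord M [1], starWord]
    ring
  rw [h1, hx, truncL_starWord]
  ring

lemma tStarReg_one (V : ℝ) : tStarReg V [1] = V := by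
  rw [tStarReg_eq, starWord]
  exact (regL_spec V).map_z_one

/-! ### Convergence of multiple `t`-star values -/

/-- Weakly decreasing odd tuples with entries less than `M`. -/
noncomputable def starTuples (M n : ℕ) : Finset (Fin n → ℕ) := by
  classical
  exact (Fintype.piFinset fun _ => Finset.range M).filter fun m => Antitone m ∧ ∀ i, Odd (m i)

lemma mem_starTuples {M n : ℕ} {m : Fin n → ℕ} :
    m ∈ starTuples M n ↔ (∀ i, m i < M) ∧ Antitone m ∧ ∀ i, Odd (m i) := by
  simp [starTuples]

lemma antitone_fin_cons {n : ℕ} {M : ℕ} {m : Fin n → ℕ} :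
    Antitone (Fin.cons M m : Fin (n + 1) → ℕ) ↔ (∀ i, m i ≤ M) ∧ Antitone m := by
  constructor
  · intro h
    refine ⟨fun i => ?_, fun i j hij => ?_⟩
    · simpa using h (Fin.zero_le i.succ)
    · simpa using h (Fin.succ_le_succ_iff.2 hij)
  · rintro ⟨h1, h2⟩ i j hij
    induction i using Fin.cases with
    | zero =>
      induction j using Fin.cases with
      | zero => exact le_rfl
      | succ j => simpa using h1 j
    | succ i =>
      induction j using Fin.cases with
      | zero => exact absurd hij (not_le.2 (Fin.succ_pos i))
      | succ j => simpa using h2 (Fin.succ_le_succ_iff.1 hij)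

lemma sum_starTuples_succ (M n : ℕ) (f : (Fin (n + 1) → ℕ) → ℝ) :
    ∑ m ∈ starTuples (M + 1) (n + 1), f m = ∑ m ∈ starTuples M (n + 1), f m
      + if Odd M then ∑ m ∈ starTuples (M + 1) n, f (Fin.cons M m) else 0 := by
  classical
  have hinj : Function.Injective (fun m : Fin n → ℕ => (Fin.cons M m : Fin (n + 1) → ℕ)) :=
    fun a b h => Fin.cons_right_injective _ h
  rw [← Finset.sum_filter_add_sum_filter_not (starTuples (M + 1) (n + 1)) (fun m => m 0 < M)]
  congr 1
  · apply Finset.sum_congr _ (fun _ _ => rfl)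
    ext m
    simp only [Finset.mem_filter, mem_starTuples]
    constructor
    · rintro ⟨⟨_, h2, h3⟩, h4⟩
      exact ⟨fun i => lt_of_le_of_lt (h2 (Fin.zero_le i)) h4, h2, h3⟩
    · rintro ⟨h1, h2, h3⟩
      exact ⟨⟨fun i => (h1 i).trans (Nat.lt_succ_self M), h2, h3⟩, h1 0⟩
  · split_ifs with hM
    · rw [← Finset.sum_image (f := f) (g := fun m : Fin n → ℕ => (Fin.cons M m : Fin (n + 1) → ℕ))
        (fun a _ b _ h => hinj h)]
      apply Finset.sum_congr _ (fun _ _ => rfl)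
      ext m
      simp only [Finset.mem_filter, mem_starTuples, Finset.mem_image]
      constructor
      · rintro ⟨⟨h1, h2, h3⟩, h4⟩
        have h0 : m 0 = M := le_antisymm (Nat.lt_succ_iff.1 (h1 0)) (not_lt.1 h4)
        have hm : (Fin.cons M (Fin.tail m) : Fin (n + 1) → ℕ) = m := by
          rw [← h0]; exact Fin.cons_self_tail m
        refine ⟨Fin.tail m, ?_, hm⟩
        rw [← hm, antitone_fin_cons] at h2
        exact ⟨fun i => Nat.lt_succ_of_le (h2.1 i), h2.2, fun i => h3 i.succ⟩
      · rintro ⟨m, ⟨h1, h2, h3⟩, rfl⟩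
        refine ⟨⟨fun i => ?_, antitone_fin_cons.2 ⟨fun i => Nat.lt_succ_iff.1 (h1 i), h2⟩,
          fun i => ?_⟩, by simp⟩
        · induction i using Fin.cases with
          | zero => simp
          | succ i => simpa using h1 i
        · induction i using Fin.cases with
          | zero => simpa using hM
          | succ i => simpa using h3 i
    · apply Finset.sum_eq_zero
      intro m hm
      simp only [Finset.mem_filter, mem_starTuples] at hm
      obtain ⟨⟨h1, h2, h3⟩, h4⟩ := hm
      have h0 : m 0 = M := le_antisymm (Nat.lt_succ_iff.1 (h1 0)) (not_lt.1 h4)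
      exact absurd (h0 ▸ h3 0) hM

lemma starTrunc_eq_sum (M : ℕ) (u : Index) :
    starTrunc M u = ∑ m ∈ starTuples M u.length, ∏ i, 1 / (m i : ℝ) ^ (u.get i : ℕ) := by
  induction u generalizing M with
  | nil =>
    have : starTuples M 0 = Finset.univ := by
      ext m; simp [mem_starTuples, Antitone, eq_iff_true_of_subsingleton]
    simp [starTrunc, this]
  | cons k u ihu =>
    induction M with
    | zero =>
      rw [starTrunc, Finset.sum_eq_zero]
      intro m hm
      exact absurd ((mem_starTuples.1 hm).1 ⟨0, by simp⟩) (Nat.not_lt_zero _)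
    | succ M ih =>
      rw [starTrunc, ih, ihu]
      refine Eq.trans ?_ (sum_starTuples_succ M u.length
        (fun m => ∏ i, 1 / (m i : ℝ) ^ (((k :: u).get i : ℕ+) : ℕ))).symm
      congr 1
      split_ifs with hM
      · rw [Finset.mul_sum]
        apply Finset.sum_congr rfl
        intro m _
        rw [Fin.prod_univ_succ]
        simp
      · simp

lemma tendsto_starTrunc {u : Index} {C : ℝ} (hC : ∀ M, starTrunc M u ≤ C) :
    Filter.Tendsto (fun M => starTrunc M u) Filter.atTop (nhds (tStar u)) := by
  classical
  let s : Set (Fin u.length → ℕ) := {m | Antitone m ∧ ∀ i, Odd (m i)}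
  let f : (Fin u.length → ℕ) → ℝ := fun m => ∏ i, 1 / (m i : ℝ) ^ (u.get i : ℕ)
  have hf : ∀ m, 0 ≤ f m := fun m => by positivity
  have hsub : ∀ m : s, ∃ M, m.1 ∈ starTuples M u.length := by
    intro m
    obtain ⟨M, hM⟩ := (Set.finite_range m.1).bddAbove
    exact ⟨M + 1, mem_starTuples.2 ⟨fun i => Nat.lt_succ_of_le (hM ⟨i, rfl⟩), m.2⟩⟩
  let A : ℕ → Finset s := fun M => (starTuples M u.length).subtype (· ∈ s)
  have hA : Monotone A := by
    intro M N h m hm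
    simp only [A, Finset.mem_subtype, mem_starTuples] at hm ⊢
    exact ⟨fun i => (hm.1 i).trans_le h, hm.2⟩
  have hex : ∀ m : s, ∃ M, m ∈ A M := by
    intro m
    obtain ⟨M, hM⟩ := hsub m
    exact ⟨M, by simpa [A] using hM⟩
  have htend := Filter.tendsto_atTop_finset_of_monotone hA hex
  have hval : ∀ M, ∑ m ∈ A M, f m.1 = starTrunc M u := by
    intro M
    rw [starTrunc_eq_sum]
    exact Finset.sum_subtype_of_mem f (fun m hm => (mem_starTuples.1 hm).2)
  have hsumm : Summable fun m : s => f m.1 := by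
    refine summable_of_sum_le (c := C) (fun m => hf m.1) fun B => ?_
    obtain ⟨M, hM⟩ := (htend.eventually (Filter.eventually_ge_atTop B)).exists
    calc ∑ m ∈ B, f m.1 ≤ ∑ m ∈ A M, f m.1 :=
          Finset.sum_le_sum_of_subset_of_nonneg hM (fun m _ _ => hf m.1)
      _ = starTrunc M u := hval M
      _ ≤ C := hC M
  exact (hsumm.hasSum.comp htend).congr fun M => hval M

open Real Polynomial

/-! ### Green polynomials -/

/-- The primitive of `-p` of order two with vanishing value and slope at `0`. -/
noncomputable def negSecondPrimitive : ℝ[X] →ₗ[ℝ] ℝ[X] :=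
  Polynomial.lsum fun n => (-(1 / (((n : ℝ) + 1) * (n + 2)))) • monomial (n + 2)

lemma negSecondPrimitive_monomial (n : ℕ) (c : ℝ) :
    negSecondPrimitive (monomial n c)
      = monomial (n + 2) (-(1 / (((n : ℝ) + 1) * (n + 2))) * c) := by
  simp [negSecondPrimitive, Polynomial.lsum_apply, smul_monomial]

lemma derivative_derivative_negSecondPrimitive (p : ℝ[X]) :
    derivative (derivative (negSecondPrimitive p)) = -p := by
  induction p using Polynomial.induction_on' with
  | add p q hp hq => simp only [map_add, hp, hq]; ring
  | monomial n c =>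
    rw [negSecondPrimitive_monomial, derivative_monomial, derivative_monomial, ← monomial_neg]
    congr 1
    push_cast
    have h1 : (n : ℝ) + 1 ≠ 0 := by positivity
    have h2 : (n : ℝ) + 2 ≠ 0 := by positivity
    field_simp

lemma eval_zero_derivative_negSecondPrimitive (p : ℝ[X]) :
    (derivative (negSecondPrimitive p)).eval 0 = 0 := by
  induction p using Polynomial.induction_on' with
  | add p q hp hq => simp only [map_add, eval_add, hp, hq, add_zero]
  | monomial n c => rw [negSecondPrimitive_monomial, derivative_monomial]; simp

lemma natDegree_negSecondPrimitive_le (p : ℝ[X]) :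
    (negSecondPrimitive p).natDegree ≤ p.natDegree + 2 := by
  conv_lhs => rw [p.as_sum_range, map_sum]
  refine natDegree_sum_le_of_forall_le _ _ fun i hi => ?_
  rw [negSecondPrimitive_monomial]
  exact (natDegree_monomial_le _).trans (by have := Finset.mem_range.1 hi; omega)

/-- The polynomials `dₙ` with `d₀ = 1`, `dₙ₊₁'' = -dₙ`, `dₙ₊₁'(0) = 0` and `dₙ₊₁(π / 2) = 0`; their
generating function is `∑ dₙ(x) Y ^ (2 n) = cos (Y x) / cos (Y π / 2)`. -/
noncomputable def greenPoly : ℕ → ℝ[X]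
  | 0 => 1
  | n + 1 => negSecondPrimitive (greenPoly n) - C ((negSecondPrimitive (greenPoly n)).eval (π / 2))

lemma derivative_derivative_greenPoly (n : ℕ) :
    derivative (derivative (greenPoly (n + 1))) = -greenPoly n := by
  simp [greenPoly, derivative_derivative_negSecondPrimitive]

lemma eval_zero_derivative_greenPoly (n : ℕ) : (derivative (greenPoly n)).eval 0 = 0 := by
  cases n <;> simp [greenPoly, eval_zero_derivative_negSecondPrimitive]

lemma eval_pi_div_two_greenPoly (n : ℕ) : (greenPoly (n + 1)).eval (π / 2) = 0 := by
  simp [greenPoly]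

lemma natDegree_greenPoly_le (n : ℕ) : (greenPoly n).natDegree ≤ 2 * n := by
  induction n with
  | zero => simp [greenPoly]
  | succ n ih =>
    rw [greenPoly]
    refine (natDegree_sub_le _ _).trans ?_
    have := natDegree_negSecondPrimitive_le (greenPoly n)
    simp only [natDegree_C]
    omega

lemma iterate_derivative_greenPoly (r n : ℕ) :
    derivative^[2 * r] (greenPoly n) = if r ≤ n then (-1) ^ r * greenPoly (n - r) else 0 := by
  induction r generalizing n with
  | zero => simp
  | succ r ih =>
    rw [show 2 * (r + 1) = 2 * r + 1 + 1 by ring, Function.iterate_succ_apply,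
      Function.iterate_succ_apply]
    cases n with
    | zero => simp [greenPoly]
    | succ n =>
      rw [derivative_derivative_greenPoly, iterate_derivative_neg, ih]
      simp only [Nat.add_le_add_iff_right, Nat.add_sub_add_right]
      split_ifs
      · ring
      · simp

lemma iterate_derivative_odd_greenPoly_eval_zero (r n : ℕ) :
    (derivative^[2 * r + 1] (greenPoly n)).eval 0 = 0 := by
  rw [Function.iterate_succ_apply', iterate_derivative_greenPoly]
  split_ifs
  · rw [show ((-1 : ℝ[X]) ^ r) = C ((-1) ^ r) by simp, derivative_C_mul, eval_mul,
      eval_zero_derivative_greenPoly, mul_zero]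
  · simp

/-! ### Second-order primitives -/

/-- `f'' = -g` and `f'(0) = 0`. -/
def NegSecondDeriv (f g : ℝ → ℝ) : Prop :=
  ∃ f' : ℝ → ℝ, (∀ x, HasDerivAt f (f' x) x) ∧ (∀ x, HasDerivAt f' (-g x) x) ∧ f' 0 = 0

lemma NegSecondDeriv.add {f g f₁ g₁ : ℝ → ℝ} (h : NegSecondDeriv f g)
    (h₁ : NegSecondDeriv f₁ g₁) :
    NegSecondDeriv (fun x => f x + f₁ x) (fun x => g x + g₁ x) := by
  obtain ⟨f', ha, hb, hc⟩ := h
  obtain ⟨f₁', ha₁, hb₁, hc₁⟩ := h₁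
  refine ⟨fun x => f' x + f₁' x, fun x => (ha x).add (ha₁ x), fun x => ?_, by simp [hc, hc₁]⟩
  exact ((hb x).add (hb₁ x)).congr_deriv (by ring)

lemma NegSecondDeriv.const_mul {f g : ℝ → ℝ} (h : NegSecondDeriv f g) (c : ℝ) :
    NegSecondDeriv (fun x => c * f x) (fun x => c * g x) := by
  obtain ⟨f', ha, hb, hc⟩ := h
  refine ⟨fun x => c * f' x, fun x => (ha x).const_mul c, fun x => ?_, by simp [hc]⟩
  exact ((hb x).const_mul c).congr_deriv (by ring)

lemma negSecondDeriv_greenPoly (n : ℕ) :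
    NegSecondDeriv (fun x => (greenPoly (n + 1)).eval x) (fun x => (greenPoly n).eval x) := by
  refine ⟨fun x => (derivative (greenPoly (n + 1))).eval x, fun x => Polynomial.hasDerivAt _ x,
    fun x => ?_, eval_zero_derivative_greenPoly _⟩
  exact (Polynomial.hasDerivAt (derivative (greenPoly (n + 1))) x).congr_deriv
    (by rw [derivative_derivative_greenPoly, eval_neg])

/-- The maximum principle on `[0, π / 2]`: a solution of `f'' = -g ≤ 0`, `f'(0) = 0`,
`f(π / 2) = 0` is nonnegative, and its slope is bounded by the integral of `g`. -/
lemma NegSecondDeriv.bounds {f g : ℝ → ℝ} (h : NegSecondDeriv f g) (hf : f (π / 2) = 0)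
    (hg : ∀ x ∈ Set.Icc 0 (π / 2), 0 ≤ g x) (hgc : Continuous g) {x : ℝ}
    (hx : x ∈ Set.Icc 0 (π / 2)) :
    0 ≤ f x ∧ f x ≤ (∫ s in (0 : ℝ)..π / 2, g s) * (π / 2 - x) := by
  obtain ⟨f', ha, hb, hc⟩ := h
  have hint : ∀ a b, IntervalIntegrable g MeasureTheory.volume a b :=
    fun a b => hgc.intervalIntegrable a b
  have hf' : ∀ x, f' x = -∫ s in (0 : ℝ)..x, g s := by
    intro x
    have := intervalIntegral.integral_eq_sub_of_hasDerivAt (a := 0) (b := x) (fun y _ => hb y)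
      (hgc.neg.intervalIntegrable _ _)
    rw [hc, sub_zero, intervalIntegral.integral_neg] at this
    exact this.symm
  have hlow : ∀ y ∈ Set.Icc 0 (π / 2), f' y ≤ 0 := by
    intro y hy
    rw [hf', neg_nonpos]
    exact intervalIntegral.integral_nonneg hy.1 fun s hs => hg s ⟨hs.1, hs.2.trans hy.2⟩
  have hup : ∀ y ∈ Set.Icc 0 (π / 2), -(∫ s in (0 : ℝ)..π / 2, g s) ≤ f' y := by
    intro y hy
    rw [hf', neg_le_neg_iff, ← intervalIntegral.integral_add_adjacent_intervals (hint 0 y)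
      (hint y (π / 2)), le_add_iff_nonneg_right]
    exact intervalIntegral.integral_nonneg hy.2 fun s hs => hg s ⟨hy.1.trans hs.1, hs.2⟩
  have hx2 : π / 2 ∈ Set.Icc 0 (π / 2) := ⟨by positivity, le_rfl⟩
  have hanti : AntitoneOn f (Set.Icc 0 (π / 2)) := by
    refine antitoneOn_of_deriv_nonpos (convex_Icc _ _)
      (fun y _ => (ha y).continuousAt.continuousWithinAt)
      (fun y _ => (ha y).differentiableAt.differentiableWithinAt) fun y hy => ?_
    rw [(ha y).deriv]
    exact hlow y (interior_subset hy)
  set E := ∫ s in (0 : ℝ)..π / 2, g s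
  have hd : ∀ y, HasDerivAt (fun y => f y + E * y) (f' y + E) y := fun y =>
    ((ha y).add ((hasDerivAt_id y).const_mul E)).congr_deriv (by rw [mul_one])
  have hmono : MonotoneOn (fun y => f y + E * y) (Set.Icc 0 (π / 2)) := by
    refine monotoneOn_of_deriv_nonneg (convex_Icc _ _)
      (fun y _ => (hd y).continuousAt.continuousWithinAt)
      (fun y _ => (hd y).differentiableAt.differentiableWithinAt) fun y hy => ?_
    rw [(hd y).deriv]
    linarith [hup y (interior_subset hy)]
  have h1 := hanti hx hx2 hx.2
  have h2 := hmono hx hx2 hx.2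
  simp only [hf] at h1 h2
  exact ⟨h1, by linarith⟩

/-! ### Wallis coefficients -/

/-- The coefficients `(2 k - 1)!! / (2 k)!!` of the series of `1 / √(1 - u ^ 2)` in `u ^ 2`. -/
noncomputable def wallisCoeff (k : ℕ) : ℝ := k.centralBinom / 4 ^ k

lemma wallisCoeff_zero : wallisCoeff 0 = 1 := by simp [wallisCoeff]

lemma wallisCoeff_pos (k : ℕ) : 0 < wallisCoeff k := by
  have : 0 < (k.centralBinom : ℝ) := by exact_mod_cast k.centralBinom_pos
  unfold wallisCoeff; positivity

lemma wallisCoeff_succ (k : ℕ) :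
    (2 * (k : ℝ) + 2) * wallisCoeff (k + 1) = (2 * k + 1) * wallisCoeff k := by
  have h : ((k : ℝ) + 1) * ((k + 1).centralBinom : ℝ) = 2 * (2 * k + 1) * k.centralBinom := by
    exact_mod_cast Nat.succ_mul_centralBinom_succ k
  rw [wallisCoeff, wallisCoeff, pow_succ]
  field_simp
  linear_combination 2 * h

lemma wallisCoeff_sq_mul_le (k : ℕ) : wallisCoeff k ^ 2 * (2 * k + 1) ≤ 1 := by
  induction k with
  | zero => simp [wallisCoeff_zero]
  | succ k ih =>
    refine le_trans ?_ ih
    have h := wallisCoeff_succ k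
    have h2 : wallisCoeff (k + 1) = (2 * k + 1) * wallisCoeff k / (2 * k + 2) := by
      rw [← h]; field_simp
    rw [h2]
    push_cast
    rw [div_pow, div_mul_eq_mul_div, div_le_iff₀ (by positivity)]
    have h3 := sq_nonneg (wallisCoeff k)
    have hk : (0 : ℝ) ≤ k := Nat.cast_nonneg k
    nlinarith [mul_nonneg h3 (by positivity : (0 : ℝ) ≤ 2 * k + 1)]

lemma tendsto_wallisCoeff : Filter.Tendsto wallisCoeff Filter.atTop (nhds 0) := by
  have h1 : Filter.Tendsto (fun k : ℕ => √(1 / ((k : ℝ) + 1))) Filter.atTop (nhds 0) := by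
    have := (continuous_sqrt.tendsto 0).comp (tendsto_one_div_add_atTop_nhds_zero_nat (𝕜 := ℝ))
    rwa [sqrt_zero] at this
  refine squeeze_zero (fun k => (wallisCoeff_pos k).le) (fun k => ?_) h1
  apply Real.le_sqrt_of_sq_le
  rw [le_div_iff₀ (by positivity)]
  refine le_trans ?_ (wallisCoeff_sq_mul_le k)
  have hk : (0 : ℝ) ≤ k := Nat.cast_nonneg k
  have := sq_nonneg (wallisCoeff k)
  nlinarith [mul_nonneg this hk]

/-! ### Trigonometric sums -/

/-- The polynomials `∑ wₖ sₖ u ^ (2 k)`, where `wₖ` is the Wallis coefficient and `sₖ` is the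
truncated `t⋆`-value of `{2}ᵃ` with the summation variables in `[2 k + 1, 2 N)`. -/
noncomputable def tailSum : ℕ → ℕ → ℝ → ℝ
  | 0, N, u => ∑ k ∈ Finset.range N, wallisCoeff k * u ^ (2 * k)
  | _ + 1, 0, _ => 0
  | a + 1, N + 1, u => tailSum (a + 1) N u + 1 / (2 * (N : ℝ) + 1) ^ 2 * tailSum a (N + 1) u
  termination_by a N => a + N

lemma tailSum_zero (N : ℕ) (u : ℝ) :
    tailSum 0 N u = ∑ k ∈ Finset.range N, wallisCoeff k * u ^ (2 * k) := by
  rw [tailSum]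

lemma tailSum_zero_succ (N : ℕ) (u : ℝ) :
    tailSum 0 (N + 1) u = tailSum 0 N u + wallisCoeff N * u ^ (2 * N) := by
  rw [tailSum_zero, tailSum_zero, Finset.sum_range_succ]

lemma tailSum_zero_right (a : ℕ) (u : ℝ) : tailSum a 0 u = 0 := by
  cases a <;> simp [tailSum]

lemma tailSum_succ (a N : ℕ) (u : ℝ) :
    tailSum (a + 1) (N + 1) u
      = tailSum (a + 1) N u + 1 / (2 * (N : ℝ) + 1) ^ 2 * tailSum a (N + 1) u := by
  rw [tailSum]

lemma continuous_tailSum (a N : ℕ) : Continuous (tailSum a N) := by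
  induction a generalizing N with
  | zero =>
    have : tailSum 0 N = fun u => ∑ k ∈ Finset.range N, wallisCoeff k * u ^ (2 * k) :=
      funext (tailSum_zero N)
    rw [this]; fun_prop
  | succ a iha =>
    induction N with
    | zero =>
      have : tailSum (a + 1) 0 = fun _ => 0 := funext (tailSum_zero_right _)
      rw [this]; fun_prop
    | succ N ih =>
      rw [funext (tailSum_succ a N)]
      exact ih.add ((iha (N + 1)).const_mul _)

/-- The derivative of `cos x ∑_{k ≤ N} wₖ sin x ^ (2 k)` telescopes to a single term. -/
lemma hasDerivAt_cos_mul_tailSum_zero (N : ℕ) (x : ℝ) :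
    HasDerivAt (fun x => cos x * tailSum 0 (N + 1) (sin x))
      (-((2 * N + 1) * wallisCoeff N * sin x ^ (2 * N + 1))) x := by
  induction N with
  | zero =>
    simpa [tailSum_zero, wallisCoeff_zero] using hasDerivAt_cos x
  | succ N ih =>
    have h : HasDerivAt (fun x => cos x * (wallisCoeff (N + 1) * sin x ^ (2 * (N + 1)))) _ x :=
      (hasDerivAt_cos x).mul (((hasDerivAt_sin x).pow (2 * (N + 1))).const_mul _)
    have h2 := ih.add h
    simp only [tailSum_zero_succ (N + 1), mul_add]
    refine h2.congr_deriv ?_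
    rw [show 2 * (N + 1) - 1 = 2 * N + 1 by omega]
    rw [← wallisCoeff_succ]
    push_cast
    have hc := sin_sq_add_cos_sq x
    linear_combination (2 * (N : ℝ) + 2) * wallisCoeff (N + 1) * sin x ^ (2 * N + 1) * hc

/-- The functions `cos x · tailSum a N (sin x)` solve the same recursive differential equation as
the polynomials `greenPoly a`. -/
lemma negSecondDeriv_tailSum (a N : ℕ) :
    NegSecondDeriv (fun x => cos x * tailSum (a + 1) N (sin x))
      (fun x => cos x * tailSum a N (sin x)) := by
  induction a generalizing N with
  | zero =>
    induction N with
    | zero =>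
      simp only [tailSum_zero_right, mul_zero]
      exact ⟨fun _ => 0, fun x => hasDerivAt_const x 0,
        fun x => by simpa using hasDerivAt_const x (0 : ℝ), rfl⟩
    | succ N ih =>
      have h0 : NegSecondDeriv (fun x => cos x * tailSum 0 (N + 1) (sin x))
          (fun x => (2 * (N : ℝ) + 1) ^ 2 * (cos x * (wallisCoeff N * sin x ^ (2 * N)))) := by
        refine ⟨_, hasDerivAt_cos_mul_tailSum_zero N, fun x => ?_, by simp⟩
        refine (((hasDerivAt_sin x).pow (2 * N + 1)).const_mul
          ((2 * N + 1) * wallisCoeff N)).neg.congr_deriv ?_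
        push_cast
        ring
      have h1 := ih.add (h0.const_mul (1 / (2 * (N : ℝ) + 1) ^ 2))
      have hN : (2 * (N : ℝ) + 1) ≠ 0 := by positivity
      convert h1 using 2 with x x
      · rw [tailSum_succ]; ring
      · rw [tailSum_zero_succ]; field_simp
  | succ a iha =>
    induction N with
    | zero =>
      simp only [tailSum_zero_right, mul_zero]
      exact ⟨fun _ => 0, fun x => hasDerivAt_const x 0,
        fun x => by simpa using hasDerivAt_const x (0 : ℝ), rfl⟩
    | succ N ih =>
      have h1 := ih.add ((iha (N + 1)).const_mul (1 / (2 * (N : ℝ) + 1) ^ 2))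
      convert h1 using 2 with x x
      · rw [tailSum_succ]; ring
      · rw [tailSum_succ a]; ring

/-- The error of the approximation of `greenPoly a` by the trigonometric sum
`cos x · tailSum a N (sin x)`. -/
noncomputable def greenError (a N : ℕ) (x : ℝ) : ℝ :=
  (greenPoly a).eval x - cos x * tailSum a N (sin x)

lemma continuous_greenError (a N : ℕ) : Continuous (greenError a N) := by
  unfold greenError
  exact (Polynomial.continuous _).sub
    (continuous_cos.mul ((continuous_tailSum a N).comp continuous_sin))

lemma negSecondDeriv_greenError (a N : ℕ) :
    NegSecondDeriv (greenError (a + 1) N) (greenError a N) := by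
  have := (negSecondDeriv_greenPoly a).add ((negSecondDeriv_tailSum a N).const_mul (-1))
  convert this using 2 with x x
  · simp only [greenError]; ring
  · simp only [greenError]; ring

lemma greenError_succ_pi_div_two (a N : ℕ) : greenError (a + 1) N (π / 2) = 0 := by
  simp [greenError, eval_pi_div_two_greenPoly]

lemma hasDerivAt_greenError_zero (N : ℕ) (x : ℝ) :
    HasDerivAt (greenError 0 (N + 1)) ((2 * N + 1) * wallisCoeff N * sin x ^ (2 * N + 1)) x := by
  have := (hasDerivAt_cos_mul_tailSum_zero N x).const_sub 1
  rw [neg_neg] at this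
  have he : greenError 0 (N + 1) = fun x => 1 - cos x * tailSum 0 (N + 1) (sin x) := by
    funext y; simp [greenError, greenPoly]
  rw [he]
  exact this

lemma tailSum_zero_at_zero (N : ℕ) : tailSum 0 (N + 1) 0 = 1 := by
  induction N with
  | zero => simp [tailSum_zero, wallisCoeff_zero]
  | succ N ih => rw [tailSum_zero_succ, ih]; simp

lemma greenError_zero_nonneg (N : ℕ) {x : ℝ} (hx : x ∈ Set.Icc 0 (π / 2)) :
    0 ≤ greenError 0 (N + 1) x := by
  have hmono : MonotoneOn (greenError 0 (N + 1)) (Set.Icc 0 (π / 2)) := by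
    refine monotoneOn_of_deriv_nonneg (convex_Icc _ _)
      (continuous_greenError _ _).continuousOn
      (fun y _ => (hasDerivAt_greenError_zero N y).differentiableAt.differentiableWithinAt)
      fun y hy => ?_
    rw [(hasDerivAt_greenError_zero N y).deriv]
    have hy' := interior_subset hy
    have : 0 ≤ sin y := sin_nonneg_of_nonneg_of_le_pi hy'.1 (by linarith [hy'.2, pi_pos])
    have := wallisCoeff_pos N
    positivity
  have h := hmono ⟨le_rfl, by positivity⟩ hx hx.1
  have h0 : greenError 0 (N + 1) 0 = 0 := by
    simp [greenError, greenPoly, tailSum_zero_at_zero]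
  rwa [h0] at h

/-- The total error at level `0` decays like the Wallis coefficients, since the derivative of the
error is a single power of the sine. -/
lemma integral_greenError_zero_le (N : ℕ) :
    ∫ x in (0 : ℝ)..π / 2, greenError 0 (N + 1) x ≤ π / 2 * wallisCoeff N := by
  have h1 := intervalIntegral.integral_mul_deriv_eq_deriv_mul (a := 0) (b := π / 2)
    (u := greenError 0 (N + 1)) (v := fun x => x - π / 2)
    (u' := fun x => (2 * N + 1) * wallisCoeff N * sin x ^ (2 * N + 1)) (v' := fun _ => 1)
    (fun x _ => hasDerivAt_greenError_zero N x) (fun x _ => (hasDerivAt_id x).sub_const _)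
    ((by fun_prop : Continuous _).intervalIntegrable _ _) (by simp)
  have h0 : greenError 0 (N + 1) 0 = 0 := by
    simp [greenError, greenPoly, tailSum_zero_at_zero]
  simp only [mul_one, sub_self, mul_zero, h0, zero_mul, zero_sub] at h1
  rw [h1, ← intervalIntegral.integral_neg]
  have h2 : ∫ x in (0 : ℝ)..π / 2,
      π / 2 * ((2 * N + 1) * wallisCoeff N) * (sin x ^ (2 * N + 1) * cos x)
      = π / 2 * ((2 * N + 1) * wallisCoeff N) * (1 / (2 * N + 2)) := by
    rw [intervalIntegral.integral_const_mul]
    congr 1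
    have := intervalIntegral.integral_eq_sub_of_hasDerivAt (a := 0) (b := π / 2)
      (f := fun x => sin x ^ (2 * N + 2) / (2 * N + 2)) (f' := fun x => sin x ^ (2 * N + 1) * cos x)
      (fun x _ => by
        refine (((hasDerivAt_sin x).pow (2 * N + 2)).div_const _).congr_deriv ?_
        push_cast
        field_simp)
      ((by fun_prop : Continuous _).intervalIntegrable _ _)
    rw [this]; simp
  have hw := wallisCoeff_pos N
  calc _ ≤ ∫ x in (0 : ℝ)..π / 2,
      π / 2 * ((2 * N + 1) * wallisCoeff N) * (sin x ^ (2 * N + 1) * cos x) := by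
        refine intervalIntegral.integral_mono_on (by positivity)
          ((by fun_prop : Continuous _).intervalIntegrable _ _)
          ((by fun_prop : Continuous _).intervalIntegrable _ _) fun x hx => ?_
        have hs : 0 ≤ sin x := sin_nonneg_of_nonneg_of_le_pi hx.1 (by linarith [hx.2, pi_pos])
        -- Jordan's inequality for the sine of `π / 2 - x`
        have hj : 2 / π * (π / 2 - x) ≤ sin (π / 2 - x) :=
          mul_le_sin (by linarith [hx.2]) (by linarith [hx.1])
        rw [sin_pi_div_two_sub] at hj
        have hj' : π / 2 - x ≤ π / 2 * cos x := by
          have := mul_le_mul_of_nonneg_left hj (by positivity : 0 ≤ π / 2)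
          rwa [← mul_assoc, show π / 2 * (2 / π) = 1 by field_simp, one_mul] at this
        have hA : 0 ≤ (2 * N + 1) * wallisCoeff N * sin x ^ (2 * N + 1) := by positivity
        nlinarith [mul_le_mul_of_nonneg_left hj' hA]
    _ = π / 2 * wallisCoeff N * ((2 * N + 1) / (2 * N + 2)) := by rw [h2]; ring
    _ ≤ π / 2 * wallisCoeff N := by
        refine mul_le_of_le_one_right (by positivity) ?_
        rw [div_le_one (by positivity)]; linarith

/-- The bound at level `0` propagates to all levels by the maximum principle. -/
lemma greenError_bounds (a N : ℕ) :
    (∀ x ∈ Set.Icc 0 (π / 2), 0 ≤ greenError a (N + 1) x) ∧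
    ∫ x in (0 : ℝ)..π / 2, greenError a (N + 1) x
      ≤ (π / 2 * (π / 2)) ^ a * (π / 2 * wallisCoeff N) := by
  induction a with
  | zero => exact ⟨fun x hx => greenError_zero_nonneg N hx, by
      simpa using integral_greenError_zero_le N⟩
  | succ a ih =>
    have h := fun x hx => (negSecondDeriv_greenError a (N + 1)).bounds
      (greenError_succ_pi_div_two a (N + 1)) ih.1 (continuous_greenError a (N + 1)) (x := x) hx
    refine ⟨fun x hx => (h x hx).1, ?_⟩
    have hI : 0 ≤ ∫ x in (0 : ℝ)..π / 2, greenError a (N + 1) x :=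
      intervalIntegral.integral_nonneg (by positivity) ih.1
    calc ∫ x in (0 : ℝ)..π / 2, greenError (a + 1) (N + 1) x
        ≤ ∫ x in (0 : ℝ)..π / 2, (∫ x in (0 : ℝ)..π / 2, greenError a (N + 1) x) * (π / 2) := by
          refine intervalIntegral.integral_mono_on (by positivity)
            ((continuous_greenError _ _).intervalIntegrable _ _) (by simp) fun x hx => ?_
          exact (h x hx).2.trans (mul_le_mul_of_nonneg_left (by linarith [hx.1]) hI)
      _ = π / 2 * (π / 2) * ∫ x in (0 : ℝ)..π / 2, greenError a (N + 1) x := by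
          rw [intervalIntegral.integral_const]; simp only [smul_eq_mul, sub_zero]; ring
      _ ≤ π / 2 * (π / 2) * ((π / 2 * (π / 2)) ^ a * (π / 2 * wallisCoeff N)) :=
          mul_le_mul_of_nonneg_left ih.2 (by positivity)
      _ = _ := by ring

lemma greenError_nonneg (a N : ℕ) {x : ℝ} (hx : x ∈ Set.Icc 0 (π / 2)) :
    0 ≤ greenError a (N + 1) x := (greenError_bounds a N).1 x hx

lemma greenError_succ_le (a N : ℕ) {x : ℝ} (hx : x ∈ Set.Icc 0 (π / 2)) :
    greenError (a + 1) (N + 1) x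
      ≤ (π / 2 * (π / 2)) ^ a * (π / 2 * wallisCoeff N) * (π / 2 - x) :=
  ((negSecondDeriv_greenError a (N + 1)).bounds (greenError_succ_pi_div_two a (N + 1))
    (greenError_bounds a N).1 (continuous_greenError a (N + 1)) hx).2.trans
    (mul_le_mul_of_nonneg_right (greenError_bounds a N).2 (by linarith [hx.2]))

/-! ### Truncated star sums as integrals -/

lemma starTrunc_two_mul_succ (N : ℕ) (k : ℕ+) (u : Index) :
    starTrunc (2 * (N + 1)) (k :: u) = starTrunc (2 * N) (k :: u)
      + 1 / (2 * (N : ℝ) + 1) ^ (k : ℕ) * starTrunc (2 * (N + 1)) u := by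
  have h1 : Odd (2 * N + 1) := odd_two_mul_add_one N
  have h2 : ¬ Odd (2 * N) := by simp
  rw [show 2 * (N + 1) = 2 * N + 1 + 1 by ring, starTrunc, starTrunc, if_pos h1, if_neg h2]
  push_cast
  ring

lemma starTrunc_nil (M : ℕ) : starTrunc M [] = 1 := by simp [starTrunc]

lemma starTrunc_zero_cons (k : ℕ+) (u : Index) : starTrunc 0 (k :: u) = 0 := by simp [starTrunc]

lemma tailSum_at_zero (a N : ℕ) :
    tailSum a (N + 1) 0 = starTrunc (2 * (N + 1)) (List.replicate a 2) := by
  induction a generalizing N with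
  | zero => rw [tailSum_zero_at_zero, List.replicate_zero, starTrunc_nil]
  | succ a iha =>
    suffices h : ∀ N, tailSum (a + 1) N 0 = starTrunc (2 * N) (List.replicate (a + 1) 2) from h _
    intro N
    induction N with
    | zero => rw [tailSum_zero_right, List.replicate_succ, mul_zero, starTrunc_zero_cons]
    | succ N ih =>
      rw [tailSum_succ, iha, ih, List.replicate_succ, starTrunc_two_mul_succ]
      rfl

lemma greenError_at_zero (a N : ℕ) : greenError a (N + 1) 0
    = (greenPoly a).eval 0 - starTrunc (2 * (N + 1)) (List.replicate a 2) := by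
  simp [greenError, tailSum_at_zero]

/-- Two integrations by parts against a power of the cosine. -/
lemma integral_cos_pow_mul_eval (p : ℝ[X]) (hp : (derivative p).eval 0 = 0) (k : ℕ) :
    (∫ x in (0 : ℝ)..π / 2, cos x ^ (k + 1) * (derivative (derivative p)).eval x)
      + (k + 1) ^ 2 * (∫ x in (0 : ℝ)..π / 2, cos x ^ (k + 1) * p.eval x)
      - (k + 1) * k * (∫ x in (0 : ℝ)..π / 2, cos x ^ (k - 1) * p.eval x)
      = (k + 1) * 0 ^ k * p.eval (π / 2) := by
  have hF : ∀ x, HasDerivAt (fun x => cos x ^ (k + 1) * (derivative p).eval x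
      + (k + 1) * (cos x ^ k * (sin x * p.eval x)))
      (cos x ^ (k + 1) * (derivative (derivative p)).eval x
        + (k + 1) ^ 2 * (cos x ^ (k + 1) * p.eval x)
        - (k + 1) * k * (cos x ^ (k - 1) * p.eval x)) x := by
    intro x
    have h1 := ((hasDerivAt_cos x).pow (k + 1)).mul (Polynomial.hasDerivAt (derivative p) x)
    have h2 := (((hasDerivAt_cos x).pow k).mul
      ((hasDerivAt_sin x).mul (Polynomial.hasDerivAt p x))).const_mul ((k : ℝ) + 1)
    refine (h1.add h2).congr_deriv ?_
    simp only [Pi.pow_apply, Pi.mul_apply, Nat.add_sub_cancel]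
    have hc := sin_sq_add_cos_sq x
    cases k with
    | zero => simp; ring
    | succ k =>
      simp only [Nat.add_sub_cancel]
      push_cast
      linear_combination (-(k + 2) * (k + 1) * cos x ^ k * p.eval x) * hc
  have hint : ∀ (j : ℕ) (c : ℝ) (r : ℝ[X]), IntervalIntegrable
      (fun x => c * (cos x ^ j * r.eval x)) MeasureTheory.volume 0 (π / 2) :=
    fun j c r => (by fun_prop : Continuous _).intervalIntegrable _ _
  have hint1 := fun j r => by simpa using hint j 1 r
  have h := intervalIntegral.integral_eq_sub_of_hasDerivAt (a := 0) (b := π / 2)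
    (fun x _ => hF x) (((hint1 _ _).add (hint _ _ _)).sub (hint _ _ _))
  rw [intervalIntegral.integral_sub ((hint1 _ _).add (hint _ _ _)) (hint _ _ _),
    intervalIntegral.integral_add (hint1 _ _) (hint _ _ _),
    intervalIntegral.integral_const_mul, intervalIntegral.integral_const_mul] at h
  rw [h]
  simp [hp]
  ring

/-- The truncated `t⋆`-values of `{2}ᵇ` are moments of `greenPoly b`. -/
lemma integral_cos_pow_mul_greenPoly (b N : ℕ) :
    (2 * N + 1) * (wallisCoeff N *
        ∫ x in (0 : ℝ)..π / 2, cos x ^ (2 * N + 1) * (greenPoly b).eval x)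
      = starTrunc (2 * (N + 1)) (List.replicate b 2) := by
  have hstep : ∀ (b N : ℕ), (∫ x in (0 : ℝ)..π / 2,
        cos x ^ (2 * N + 3) * (derivative (derivative (greenPoly b))).eval x)
      + (2 * N + 3) ^ 2 * (∫ x in (0 : ℝ)..π / 2, cos x ^ (2 * N + 3) * (greenPoly b).eval x)
      - (2 * N + 3) * (2 * N + 2) *
        (∫ x in (0 : ℝ)..π / 2, cos x ^ (2 * N + 1) * (greenPoly b).eval x) = 0 := by
    intro b N
    have h := integral_cos_pow_mul_eval (greenPoly b) (eval_zero_derivative_greenPoly b) (2 * N + 2)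
    rw [show 2 * N + 2 - 1 = 2 * N + 1 by omega, show 2 * N + 2 + 1 = 2 * N + 3 by ring] at h
    push_cast at h
    rw [zero_pow (by omega), mul_zero, zero_mul] at h
    linear_combination h
  induction b generalizing N with
  | zero =>
    rw [List.replicate_zero, starTrunc_nil]
    induction N with
    | zero =>
      simp [greenPoly, wallisCoeff_zero]
    | succ N ih =>
      have h := hstep 0 N
      simp only [greenPoly, derivative_one, derivative_zero, eval_zero, eval_one, mul_zero,
        intervalIntegral.integral_zero, zero_add, mul_one] at h ih ⊢
      have hw := wallisCoeff_succ N
      rw [show 2 * (N + 1) + 1 = 2 * N + 3 by ring]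
      push_cast
      have h3 : (2 * (N : ℝ) + 3) ≠ 0 := by positivity
      apply mul_left_cancel₀ h3
      linear_combination wallisCoeff (N + 1) * h + (2 * (N : ℝ) + 3) * ih
        + (2 * (N : ℝ) + 3) * (∫ x in (0 : ℝ)..π / 2, cos x ^ (2 * N + 1)) * hw
  | succ b ihb =>
    have hneg : ∀ m : ℕ, (∫ x in (0 : ℝ)..π / 2,
        cos x ^ m * (derivative (derivative (greenPoly (b + 1)))).eval x)
        = -∫ x in (0 : ℝ)..π / 2, cos x ^ m * (greenPoly b).eval x := by
      intro m
      rw [← intervalIntegral.integral_neg]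
      simp only [derivative_derivative_greenPoly, eval_neg, mul_neg]
    induction N with
    | zero =>
      have h := integral_cos_pow_mul_eval (greenPoly (b + 1))
        (eval_zero_derivative_greenPoly (b + 1)) 0
      rw [hneg, eval_pi_div_two_greenPoly] at h
      have h2 := ihb 0
      rw [List.replicate_succ, starTrunc_two_mul_succ, ← h2, mul_zero, starTrunc_zero_cons]
      norm_num [wallisCoeff_zero] at h ⊢
      linear_combination h
    | succ N ih =>
      have h := hstep (b + 1) N
      rw [hneg] at h
      have h2 := ihb (N + 1)
      have hw := wallisCoeff_succ N
      rw [List.replicate_succ, starTrunc_two_mul_succ, ← h2, ← List.replicate_succ, ← ih]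
      rw [show 2 * (N + 1) + 1 = 2 * N + 3 by ring]
      push_cast
      have h3 : (2 * (N : ℝ) + 3) ≠ 0 := by positivity
      rw [show (2 * ((N : ℝ) + 1) + 1) = 2 * N + 3 by ring]
      field_simp
      linear_combination wallisCoeff (N + 1) * h
        + (2 * (N : ℝ) + 3) * (∫ x in (0 : ℝ)..π / 2,
          cos x ^ (2 * N + 1) * (greenPoly (b + 1)).eval x) * hw

lemma intervalIntegrable_greenPoly_mul_tailSum (b a N : ℕ) :
    IntervalIntegrable (fun x => (greenPoly b).eval x * (cos x * tailSum a N (cos x)))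
      MeasureTheory.volume 0 (π / 2) :=
  ((Polynomial.continuous _).mul (continuous_cos.mul
    ((continuous_tailSum a N).comp continuous_cos))).intervalIntegrable _ _

/-- Both sides obey the same recursion in `a` and `N`; for `a = 0` it is the moment formula. -/
lemma starTrunc_two_one_two_eq_integral (a b N : ℕ) :
    starTrunc (2 * N) (List.replicate a 2 ++ 1 :: List.replicate b 2)
      = ∫ x in (0 : ℝ)..π / 2, (greenPoly b).eval x * (cos x * tailSum a N (cos x)) := by
  have hint := intervalIntegrable_greenPoly_mul_tailSum b
  induction a generalizing N with
  | zero =>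
    rw [List.replicate_zero, List.nil_append]
    induction N with
    | zero => simp [starTrunc_zero_cons, tailSum_zero]
    | succ N ih =>
      rw [starTrunc_two_mul_succ, ih, ← integral_cos_pow_mul_greenPoly]
      have h1 : (fun x => (greenPoly b).eval x * (cos x * tailSum 0 (N + 1) (cos x)))
          = fun x => (greenPoly b).eval x * (cos x * tailSum 0 N (cos x))
            + wallisCoeff N * (cos x ^ (2 * N + 1) * (greenPoly b).eval x) := by
        funext x; rw [tailSum_zero_succ]; ring
      rw [h1, intervalIntegral.integral_add (hint 0 N)
        ((by fun_prop : Continuous _).intervalIntegrable _ _), intervalIntegral.integral_const_mul]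
      have h3 : (2 * (N : ℝ) + 1) ≠ 0 := by positivity
      simp only [PNat.one_coe, pow_one]
      field_simp
  | succ a iha =>
    induction N with
    | zero => simp [List.replicate_succ, starTrunc_zero_cons, tailSum_zero_right]
    | succ N ih =>
      have h1 : (fun x => (greenPoly b).eval x * (cos x * tailSum (a + 1) (N + 1) (cos x)))
          = fun x => (greenPoly b).eval x * (cos x * tailSum (a + 1) N (cos x))
            + 1 / (2 * (N : ℝ) + 1) ^ 2
              * ((greenPoly b).eval x * (cos x * tailSum a (N + 1) (cos x))) := by
        funext x; rw [tailSum_succ]; ring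
      rw [h1, intervalIntegral.integral_add (hint (a + 1) N) ((hint a (N + 1)).const_mul _),
        intervalIntegral.integral_const_mul, ← iha, ← ih, List.replicate_succ, List.cons_append,
        starTrunc_two_mul_succ]
      rfl

/-! ### Values at the origin -/

lemma tendsto_mul_wallisCoeff (c : ℝ) :
    Filter.Tendsto (fun N => c * wallisCoeff N) Filter.atTop (nhds 0) := by
  simpa using tendsto_wallisCoeff.const_mul c

lemma tendsto_starTrunc_two (n : ℕ) :
    Filter.Tendsto (fun N => starTrunc (2 * (N + 1)) (List.replicate n 2)) Filter.atTop
      (nhds ((greenPoly n).eval 0)) := by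
  cases n with
  | zero => simp [starTrunc_nil, greenPoly]
  | succ n =>
    have h0 : (0 : ℝ) ∈ Set.Icc 0 (π / 2) := ⟨le_rfl, by positivity⟩
    have h : Filter.Tendsto (fun N => greenError (n + 1) (N + 1) 0) Filter.atTop (nhds 0) := by
      refine squeeze_zero (fun N => greenError_nonneg _ _ h0) (fun N => ?_)
        (tendsto_mul_wallisCoeff ((π / 2 * (π / 2)) ^ n * (π / 2) * (π / 2)))
      refine (greenError_succ_le n N h0).trans (le_of_eq ?_)
      ring
    have h2 := h.const_sub ((greenPoly (n + 1)).eval 0)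
    simpa [greenError_at_zero] using h2

lemma tendsto_two_mul_succ :
    Filter.Tendsto (fun N : ℕ => 2 * (N + 1)) Filter.atTop Filter.atTop :=
  Filter.tendsto_atTop_mono (fun N => by simp only [id_eq]; omega) Filter.tendsto_id

lemma starTrunc_nonneg (M : ℕ) (u : Index) : 0 ≤ starTrunc M u := by
  rw [starTrunc_eq_sum]; positivity

lemma starTrunc_mono (u : Index) : Monotone fun M => starTrunc M u := by
  refine monotone_nat_of_le_succ fun M => ?_
  cases u with
  | nil => simp [starTrunc_nil]
  | cons k u =>
    rw [starTrunc]
    have := starTrunc_nonneg (M + 1) u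
    split_ifs
    · have h : (0 : ℝ) ≤ 1 / (M : ℝ) ^ (k : ℕ) := by positivity
      nlinarith [mul_nonneg h this]
    · simp

lemma tStar_two (n : ℕ) : tStar (List.replicate n 2) = (greenPoly n).eval 0 := by
  have hmono := starTrunc_mono (List.replicate n 2)
  have hC : ∀ M, starTrunc M (List.replicate n 2) ≤ (greenPoly n).eval 0 := by
    intro M
    refine (hmono (by omega : M ≤ 2 * (M + 1))).trans ?_
    exact Monotone.ge_of_tendsto (f := fun N => starTrunc (2 * (N + 1)) (List.replicate n 2))
      (fun i j h => hmono (by omega)) (tendsto_starTrunc_two n) M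
  exact tendsto_nhds_unique ((tendsto_starTrunc hC).comp tendsto_two_mul_succ)
    (tendsto_starTrunc_two n)

/-! ### Passage to the limit -/

/-- The function `x cot x`, without its removable singularity at `0`. -/
noncomputable def mulCot (x : ℝ) : ℝ := cos x / sinc x

lemma sinc_pos_of_mem {x : ℝ} (hx : x ∈ Set.Icc 0 (π / 2)) : 0 < sinc x := by
  rcases hx.1.eq_or_lt with h | h
  · rw [← h, sinc_zero]; exact one_pos
  · rw [sinc_of_ne_zero h.ne']
    exact div_pos (sin_pos_of_pos_of_lt_pi h (by linarith [hx.2, pi_pos])) h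

lemma continuousOn_mulCot : ContinuousOn mulCot (Set.Icc 0 (π / 2)) :=
  continuous_cos.continuousOn.div continuous_sinc.continuousOn fun _ hx => (sinc_pos_of_mem hx).ne'

lemma mulCot_mul_sin {x : ℝ} (hx : x ∈ Set.Icc 0 (π / 2)) : mulCot x * sin x = x * cos x := by
  have h := sinc_pos_of_mem hx
  rcases hx.1.eq_or_lt with h0 | h0
  · simp [← h0]
  · rw [mulCot, sinc_of_ne_zero h0.ne']
    rw [sinc_of_ne_zero h0.ne'] at h
    have hs : sin x ≠ 0 := fun hs => by simp [hs] at h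
    field_simp

lemma two_div_pi_le_sinc {x : ℝ} (hx : x ∈ Set.Icc 0 (π / 2)) : 2 / π ≤ sinc x := by
  rcases hx.1.eq_or_lt with h | h
  · rw [← h, sinc_zero, div_le_one pi_pos]; exact two_le_pi
  · rw [sinc_of_ne_zero h.ne', le_div_iff₀ h]
    exact mul_le_sin hx.1 hx.2

lemma mulCot_mem {x : ℝ} (hx : x ∈ Set.Icc 0 (π / 2)) : 0 ≤ mulCot x ∧ mulCot x ≤ π / 2 := by
  have hc : 0 ≤ cos x := cos_nonneg_of_mem_Icc ⟨by linarith [hx.1, pi_pos], hx.2⟩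
  have hs := sinc_pos_of_mem hx
  refine ⟨div_nonneg hc hs.le, ?_⟩
  rw [mulCot, div_le_iff₀ hs]
  have := mul_le_mul_of_nonneg_left (two_div_pi_le_sinc hx) (by positivity : 0 ≤ π / 2)
  rw [show π / 2 * (2 / π) = 1 by field_simp] at this
  exact (cos_le_one x).trans this

lemma intervalIntegrable_eval_mul_mulCot (q : ℝ[X]) :
    IntervalIntegrable (fun x => q.eval x * mulCot x) MeasureTheory.volume 0 (π / 2) := by
  refine ContinuousOn.intervalIntegrable ?_
  rw [Set.uIcc_of_le (by positivity)]
  exact (Polynomial.continuous _).continuousOn.mul continuousOn_mulCot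

lemma exists_abs_eval_le (q : ℝ[X]) : ∃ C, 0 ≤ C ∧ ∀ x ∈ Set.Icc 0 (π / 2), |q.eval x| ≤ C := by
  obtain ⟨C, hC⟩ := (isCompact_Icc (a := (0 : ℝ)) (b := π / 2)).exists_bound_of_continuousOn
    (Polynomial.continuous q).continuousOn
  exact ⟨C, (norm_nonneg _).trans (hC 0 ⟨le_rfl, by positivity⟩), hC⟩

lemma mem_Icc_of_mem_uIoc {x : ℝ} (hx : x ∈ Set.uIoc 0 (π / 2)) :
    0 < x ∧ x ∈ Set.Icc 0 (π / 2) ∧ π / 2 - x ∈ Set.Icc 0 (π / 2) := by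
  rw [Set.uIoc_of_le (by positivity)] at hx
  exact ⟨hx.1, ⟨hx.1.le, hx.2⟩, by linarith [hx.2], by linarith [hx.1]⟩

/-- If the first entry is not `1`, the truncated sums tend to
`∫ dᵦ(x) dₐ₊₁(π / 2 - x) cot x`. -/
lemma tendsto_integral_tailSum_succ (a b : ℕ) {q : ℝ[X]}
    (hq : (greenPoly (a + 1)).comp (C (π / 2) - X) = X * q) :
    Filter.Tendsto (fun N => ∫ x in (0 : ℝ)..π / 2,
      (greenPoly b).eval x * (cos x * tailSum (a + 1) (N + 1) (cos x))) Filter.atTop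
      (nhds (∫ x in (0 : ℝ)..π / 2, (greenPoly b * q).eval x * mulCot x)) := by
  obtain ⟨K, hK0, hK⟩ := exists_abs_eval_le (greenPoly b)
  rw [tendsto_iff_norm_sub_tendsto_zero]
  refine squeeze_zero (fun _ => norm_nonneg _) (fun N => ?_)
    (tendsto_mul_wallisCoeff (K * (π / 2 * ((π / 2 * (π / 2)) ^ a * (π / 2))) * (π / 2)))
  rw [norm_sub_rev, ← intervalIntegral.integral_sub (intervalIntegrable_eval_mul_mulCot _)
    (intervalIntegrable_greenPoly_mul_tailSum _ _ _)]
  refine (intervalIntegral.norm_integral_le_of_norm_le_const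
    (C := K * (π / 2 * ((π / 2 * (π / 2)) ^ a * (π / 2 * wallisCoeff N)))) fun x hx => ?_).trans
    (le_of_eq ?_)
  · obtain ⟨h0, hx, hx'⟩ := mem_Icc_of_mem_uIoc hx
    have hE := greenError_succ_le a N hx'
    have hE0 := greenError_nonneg (a + 1) N hx'
    rw [sub_sub_cancel] at hE
    have hev : (greenPoly (a + 1)).eval (π / 2 - x) = x * q.eval x := by
      have := congrArg (eval x) hq
      simpa using this
    have hkey : x * ((greenPoly b * q).eval x * mulCot x
        - (greenPoly b).eval x * (cos x * tailSum (a + 1) (N + 1) (cos x)))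
        = (greenPoly b).eval x * (mulCot x * greenError (a + 1) (N + 1) (π / 2 - x)) := by
      rw [greenError, hev, cos_pi_div_two_sub, sin_pi_div_two_sub, eval_mul]
      linear_combination ((greenPoly b).eval x * tailSum (a + 1) (N + 1) (cos x))
        * mulCot_mul_sin hx
    have hmc := mulCot_mem hx
    rw [← mul_le_mul_iff_right₀ h0]
    calc x * ‖_‖ = |x * ((greenPoly b * q).eval x * mulCot x
        - (greenPoly b).eval x * (cos x * tailSum (a + 1) (N + 1) (cos x)))| := by
          rw [abs_mul, abs_of_pos h0, norm_eq_abs]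
      _ = |(greenPoly b).eval x| * (mulCot x * greenError (a + 1) (N + 1) (π / 2 - x)) := by
          rw [hkey, abs_mul, abs_of_nonneg (mul_nonneg hmc.1 hE0)]
      _ ≤ K * (π / 2 * ((π / 2 * (π / 2)) ^ a * (π / 2 * wallisCoeff N) * x)) :=
          mul_le_mul (hK x hx) (mul_le_mul hmc.2 hE hE0 (by positivity))
            (mul_nonneg hmc.1 hE0) hK0
      _ = _ := by ring
  · rw [sub_zero, abs_of_pos (by positivity)]; ring

/-- If the first entry is `1`, the truncated sums, with `dᵦ(0)` subtracted from `dᵦ`, tend to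
`∫ (dᵦ(x) - dᵦ(0)) cot x`. -/
lemma tendsto_integral_tailSum_zero {b : ℕ} {q : ℝ[X]}
    (hq : greenPoly b - C ((greenPoly b).eval 0) = X * (X * q)) :
    Filter.Tendsto (fun N => ∫ x in (0 : ℝ)..π / 2,
      ((greenPoly b).eval x - (greenPoly b).eval 0) * (cos x * tailSum 0 (N + 1) (cos x)))
      Filter.atTop (nhds (∫ x in (0 : ℝ)..π / 2, (X * q).eval x * mulCot x)) := by
  obtain ⟨K, hK0, hK⟩ := exists_abs_eval_le (X * q)
  rw [tendsto_iff_norm_sub_tendsto_zero]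
  refine squeeze_zero (fun _ => norm_nonneg _) (fun N => ?_)
    (tendsto_mul_wallisCoeff (K * (π / 2) * (π / 2)))
  have hcont : Continuous fun x => greenError 0 (N + 1) (π / 2 - x) :=
    (continuous_greenError 0 (N + 1)).comp (by fun_prop)
  have hint : IntervalIntegrable (fun x => ((greenPoly b).eval x - (greenPoly b).eval 0)
      * (cos x * tailSum 0 (N + 1) (cos x))) MeasureTheory.volume 0 (π / 2) :=
    (((Polynomial.continuous _).sub continuous_const).mul (continuous_cos.mul
      ((continuous_tailSum 0 (N + 1)).comp continuous_cos))).intervalIntegrable _ _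
  rw [norm_sub_rev, ← intervalIntegral.integral_sub (intervalIntegrable_eval_mul_mulCot _) hint]
  have hle : ∀ x ∈ Set.Ioc 0 (π / 2), ‖(X * q).eval x * mulCot x
      - ((greenPoly b).eval x - (greenPoly b).eval 0) * (cos x * tailSum 0 (N + 1) (cos x))‖
      ≤ K * (π / 2) * greenError 0 (N + 1) (π / 2 - x) := by
    intro x hx
    rw [← Set.uIoc_of_le (by positivity)] at hx
    obtain ⟨h0, hx, hx'⟩ := mem_Icc_of_mem_uIoc hx
    have hE0 := greenError_nonneg 0 N hx'
    have hev : (greenPoly b).eval x - (greenPoly b).eval 0 = x * (X * q).eval x := by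
      have := congrArg (eval x) hq
      simpa using this
    have hmc := mulCot_mem hx
    have hkey : (X * q).eval x * mulCot x
        - ((greenPoly b).eval x - (greenPoly b).eval 0) * (cos x * tailSum 0 (N + 1) (cos x))
        = (X * q).eval x * (mulCot x * greenError 0 (N + 1) (π / 2 - x)) := by
      rw [greenError, hev, cos_pi_div_two_sub, sin_pi_div_two_sub, greenPoly, eval_one]
      linear_combination ((X * q).eval x * tailSum 0 (N + 1) (cos x)) * mulCot_mul_sin hx
    rw [hkey, norm_eq_abs, abs_mul, abs_of_nonneg (mul_nonneg hmc.1 hE0), mul_assoc]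
    exact mul_le_mul (hK x hx) (mul_le_mul_of_nonneg_right hmc.2 hE0) (mul_nonneg hmc.1 hE0) hK0
  refine (intervalIntegral.norm_integral_le_of_norm_le (by positivity)
    (Filter.Eventually.of_forall hle) ((hcont.const_mul _).intervalIntegrable _ _)).trans ?_
  rw [intervalIntegral.integral_const_mul,
    intervalIntegral.integral_comp_sub_left (greenError 0 (N + 1)) (π / 2), sub_self, sub_zero,
    mul_assoc (K * (π / 2))]
  exact mul_le_mul_of_nonneg_left (integral_greenError_zero_le N) (by positivity)

/-- `greenPoly b` is constant up to second order at `0`. -/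
lemma exists_greenPoly_sub_eq (b : ℕ) :
    ∃ q : ℝ[X], greenPoly b - C ((greenPoly b).eval 0) = X * (X * q) := by
  have h : X ^ 2 ∣ greenPoly b - C ((greenPoly b).eval 0) := by
    rw [X_pow_dvd_iff]
    intro d hd
    interval_cases d
    · simp [coeff_zero_eq_eval_zero]
    · have := eval_zero_derivative_greenPoly b
      rw [← coeff_zero_eq_eval_zero, coeff_derivative] at this
      simpa [coeff_C] using this
  obtain ⟨q, hq⟩ := h
  exact ⟨q, by rw [hq]; ring⟩

/-- The truncation error of `t⋆({2}ᵇ)` is `O(1 / N)`: as `dᵦ(x) - dᵦ(0) = O(sin x ^ 2)`, it is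
bounded by the mean of `sin x ^ 2` for the density proportional to `cos x ^ (2 N + 1)`, which is
`1 / (2 N + 3)`. -/
lemma abs_starTrunc_sub_le (b : ℕ) : ∃ K, 0 ≤ K ∧ ∀ N : ℕ,
    |starTrunc (2 * (N + 1)) (List.replicate b 2) - (greenPoly b).eval 0| ≤ K / (2 * N + 3) := by
  obtain ⟨q, hq⟩ := exists_greenPoly_sub_eq b
  obtain ⟨K, hK0, hK⟩ := exists_abs_eval_le q
  refine ⟨K * (π / 2) ^ 2, by positivity, fun N => ?_⟩
  have hone : ∀ N : ℕ, (2 * N + 1) * (wallisCoeff N * ∫ x in (0 : ℝ)..π / 2, cos x ^ (2 * N + 1))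
      = 1 := by
    intro N
    simpa [greenPoly, starTrunc_nil] using integral_cos_pow_mul_greenPoly 0 N
  have hw := wallisCoeff_pos N
  have hint : ∀ p : ℝ[X], IntervalIntegrable (fun x => cos x ^ (2 * N + 1) * p.eval x)
      MeasureTheory.volume 0 (π / 2) :=
    fun p => (by fun_prop : Continuous _).intervalIntegrable _ _
  have h1 : starTrunc (2 * (N + 1)) (List.replicate b 2) - (greenPoly b).eval 0
      = (2 * N + 1) * wallisCoeff N
        * ∫ x in (0 : ℝ)..π / 2, cos x ^ (2 * N + 1) * (X * (X * q)).eval x := by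
    rw [← hq, ← integral_cos_pow_mul_greenPoly]
    simp only [eval_sub, eval_C, mul_sub]
    rw [intervalIntegral.integral_sub (hint _)
      ((by fun_prop : Continuous _).intervalIntegrable _ _), intervalIntegral.integral_mul_const]
    linear_combination (greenPoly b).eval 0 * hone N
  have h2 : ‖∫ x in (0 : ℝ)..π / 2, cos x ^ (2 * N + 1) * (X * (X * q)).eval x‖
      ≤ ∫ x in (0 : ℝ)..π / 2,
        K * (π / 2) ^ 2 * (cos x ^ (2 * N + 1) - cos x ^ (2 * (N + 1) + 1)) := by
    refine intervalIntegral.norm_integral_le_of_norm_le (by positivity)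
      (Filter.Eventually.of_forall fun x hx => ?_)
      ((by fun_prop : Continuous _).intervalIntegrable _ _)
    have hx' : x ∈ Set.Icc 0 (π / 2) := ⟨hx.1.le, hx.2⟩
    have hc : 0 ≤ cos x := cos_nonneg_of_mem_Icc ⟨by linarith [hx.1, pi_pos], hx.2⟩
    have hj : x ≤ π / 2 * sin x := by
      have := mul_le_mul_of_nonneg_left (mul_le_sin hx.1.le hx.2) (by positivity : 0 ≤ π / 2)
      rwa [← mul_assoc, show π / 2 * (2 / π) = 1 by field_simp, one_mul] at this
    have hj2 : x * x ≤ (π / 2) ^ 2 * sin x ^ 2 := by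
      nlinarith [hx.1, mul_le_mul hj hj hx.1.le (hx.1.le.trans hj)]
    have hP : 0 ≤ cos x ^ (2 * N + 1) := by positivity
    have h3 : |q.eval x| * (x * x) ≤ K * ((π / 2) ^ 2 * sin x ^ 2) :=
      mul_le_mul (hK x hx') hj2 (mul_self_nonneg x) hK0
    simp only [eval_mul, eval_X, norm_eq_abs, abs_mul, abs_of_pos hx.1, abs_of_nonneg hP]
    calc _ = cos x ^ (2 * N + 1) * (|q.eval x| * (x * x)) := by ring
      _ ≤ cos x ^ (2 * N + 1) * (K * ((π / 2) ^ 2 * sin x ^ 2)) :=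
          mul_le_mul_of_nonneg_left h3 hP
      _ = _ := by rw [sin_sq]; ring
  have h3 : (2 * N + 1) * wallisCoeff N * ∫ x in (0 : ℝ)..π / 2,
      K * (π / 2) ^ 2 * (cos x ^ (2 * N + 1) - cos x ^ (2 * (N + 1) + 1))
      = K * (π / 2) ^ 2 / (2 * N + 3) := by
    rw [intervalIntegral.integral_const_mul, intervalIntegral.integral_sub
      ((by fun_prop : Continuous _).intervalIntegrable _ _)
      ((by fun_prop : Continuous _).intervalIntegrable _ _)]
    have ha := hone N
    have hb := hone (N + 1)
    have hc := wallisCoeff_succ N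
    push_cast at hb
    have hN : (2 * (N : ℝ) + 3) ≠ 0 := by positivity
    rw [eq_div_iff hN]
    linear_combination K * (π / 2) ^ 2 * ((2 * (N : ℝ) + 3) * ha - (2 * (N : ℝ) + 2) * hb
      + (2 * (N : ℝ) + 3) * (∫ x in (0 : ℝ)..π / 2, cos x ^ (2 * (N + 1) + 1)) * hc)
  rw [h1, ← h3, abs_mul, abs_of_pos (by positivity)]
  exact mul_le_mul_of_nonneg_left h2 (by positivity)

/-- The truncations of `t(1)`, of size `O(√N)`, are too small to see the truncation error of
`t⋆({2}ᵇ)`. -/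
lemma tendsto_starTrunc_one_mul_sub (b : ℕ) :
    Filter.Tendsto (fun N => starTrunc (2 * (N + 1)) [1]
      * (starTrunc (2 * (N + 1)) (List.replicate b 2) - (greenPoly b).eval 0))
      Filter.atTop (nhds 0) := by
  obtain ⟨K, hK0, hK⟩ := abs_starTrunc_sub_le b
  have h1 : Filter.Tendsto (fun N : ℕ => 3 * K * √(1 / ((N : ℝ) + 1))) Filter.atTop (nhds 0) := by
    have := (continuous_sqrt.tendsto 0).comp (tendsto_one_div_add_atTop_nhds_zero_nat (𝕜 := ℝ))
    rw [sqrt_zero] at this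
    simpa using this.const_mul (3 * K)
  refine squeeze_zero_norm (fun N => ?_) h1
  have hH : starTrunc (2 * (N + 1)) [1] ≤ 3 * √(2 * (N + 1)) := by
    have h := trunc_le_sqrt (2 * (N + 1)) (by omega) [1]
    rw [← truncL_starWord, starWord, truncL_word]
    simpa using h
  have hH0 := starTrunc_nonneg (2 * (N + 1)) [1]
  rw [norm_mul, norm_eq_abs, norm_eq_abs, abs_of_nonneg hH0]
  refine (mul_le_mul hH (hK N) (abs_nonneg _) (by positivity)).trans ?_
  have hs : √(2 * ((N : ℝ) + 1)) / (2 * N + 3) ≤ √(1 / ((N : ℝ) + 1)) := by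
    apply Real.le_sqrt_of_sq_le
    rw [div_pow, sq_sqrt (by positivity), div_le_div_iff₀ (by positivity) (by positivity)]
    nlinarith [(Nat.cast_nonneg N : (0 : ℝ) ≤ N)]
  calc _ = 3 * K * (√(2 * ((N : ℝ) + 1)) / (2 * N + 3)) := by ring
    _ ≤ _ := mul_le_mul_of_nonneg_left hs (by positivity)

lemma tStarReg_two_succ_eq_integral (V : ℝ) (a b : ℕ) {q : ℝ[X]}
    (hq : (greenPoly (a + 1)).comp (C (π / 2) - X) = X * q) :
    tStarReg V (List.replicate (a + 1) 2 ++ 1 :: List.replicate b 2)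
      = ∫ x in (0 : ℝ)..π / 2, (greenPoly b * q).eval x * mulCot x := by
  have h1 := (tendsto_starTrunc_tStarReg V 2 (by decide)
    (List.replicate a 2 ++ 1 :: List.replicate b 2)).comp tendsto_two_mul_succ
  have h2 := tendsto_integral_tailSum_succ a b hq
  refine tendsto_nhds_unique h1 (h2.congr fun N => ?_)
  rw [← starTrunc_two_one_two_eq_integral]
  rfl

lemma tStarReg_one_two_eq_integral (V : ℝ) (b : ℕ) {q : ℝ[X]}
    (hq : greenPoly b - C ((greenPoly b).eval 0) = X * (X * q)) :
    tStarReg V (1 :: List.replicate b 2)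
      = (∫ x in (0 : ℝ)..π / 2, (X * q).eval x * mulCot x) + V * (greenPoly b).eval 0 := by
  cases b with
  | zero =>
    have hq0 : q = 0 := by simpa [greenPoly] using hq
    simp [hq0, tStarReg_one, greenPoly]
  | succ b =>
    have h1 := (tendsto_starTrunc_one_cons V 2 (by decide)
      (List.replicate b 2)).comp tendsto_two_mul_succ
    have h2 := ((tendsto_integral_tailSum_zero hq).add
      ((tendsto_starTrunc_two (b + 1)).const_mul V)).sub (tendsto_starTrunc_one_mul_sub (b + 1))
    rw [sub_zero] at h2
    refine tendsto_nhds_unique h1 (h2.congr fun N => ?_)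
    have e1 := starTrunc_two_one_two_eq_integral 0 (b + 1) (N + 1)
    have e2 := starTrunc_two_one_two_eq_integral 0 0 (N + 1)
    have hint := intervalIntegrable_greenPoly_mul_tailSum
    simp only [greenPoly, eval_one, one_mul, List.replicate_zero, List.nil_append] at e1 e2
    have hint0 := hint 0 0 (N + 1)
    simp only [greenPoly, eval_one, one_mul] at hint0
    simp only [sub_mul, Function.comp_apply]
    rw [intervalIntegral.integral_sub (hint (b + 1) 0 (N + 1)) (hint0.const_mul _),
      intervalIntegral.integral_const_mul, ← e2]
    have e3 : starTrunc (2 * (N + 1)) (1 :: 2 :: List.replicate b 2)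
        = ∫ x in (0 : ℝ)..π / 2,
          (greenPoly (b + 1)).eval x * (cos x * tailSum 0 (N + 1) (cos x)) := by
      rw [← starTrunc_two_one_two_eq_integral]; rfl
    rw [e3, List.replicate_succ]
    ring

/-! ### Integrals against the cotangent -/

/-- The Riemann–Lebesgue lemma on `[0, π / 2]`. -/
lemma tendsto_integral_mul_cos {g : ℝ → ℝ} (hg : ContinuousOn g (Set.Icc 0 (π / 2))) :
    Filter.Tendsto (fun N : ℕ => ∫ x in (0 : ℝ)..π / 2, g x * cos ((2 * N + 1) * x))
      Filter.atTop (nhds 0) := by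
  set f : ℝ → ℂ := Set.indicator (Set.Ioc 0 (π / 2)) (fun x => (g x : ℂ)) with hf
  have hw : Filter.Tendsto (fun N : ℕ => (2 * (N : ℝ) + 1) / (2 * π)) Filter.atTop
      (Filter.cocompact ℝ) := by
    refine Filter.Tendsto.mono_right ?_ atTop_le_cocompact
    refine Filter.Tendsto.atTop_div_const (by positivity) ?_
    exact Filter.tendsto_atTop_add_const_right _ _
      (tendsto_natCast_atTop_atTop.const_mul_atTop two_pos)
  have h := (Complex.continuous_re.tendsto 0).comp
    ((Real.tendsto_integral_exp_smul_cocompact f).comp hw)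
  rw [Complex.zero_re] at h
  refine h.congr fun N => ?_
  set w : ℝ := (2 * (N : ℝ) + 1) / (2 * π) with hwdef
  have e1 : (fun v => Real.fourierChar (-(v * w)) • f v)
      = Set.indicator (Set.Ioc 0 (π / 2))
        (fun v => Real.fourierChar (-(v * w)) • (g v : ℂ)) := by
    funext v
    by_cases hv : v ∈ Set.Ioc 0 (π / 2) <;> simp [hf, hv]
  have hint : IntervalIntegrable (fun v => Real.fourierChar (-(v * w)) • (g v : ℂ))
      MeasureTheory.volume 0 (π / 2) := by
    refine ContinuousOn.intervalIntegrable ?_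
    rw [Set.uIcc_of_le (by positivity)]
    exact (Real.continuous_fourierChar.comp (by fun_prop)).continuousOn.smul
      (Complex.continuous_ofReal.comp_continuousOn hg)
  simp only [Function.comp_apply]
  rw [e1, MeasureTheory.integral_indicator measurableSet_Ioc,
    ← intervalIntegral.integral_of_le (by positivity), ← Complex.reCLM_apply,
    ← Complex.reCLM.intervalIntegral_comp_comm hint]
  refine intervalIntegral.integral_congr fun v _ => ?_
  have e2 : 2 * π * -(v * w) = -((2 * N + 1) * v) := by rw [hwdef]; field_simp
  simp only [Complex.reCLM_apply, Circle.smul_def, smul_eq_mul, Complex.re_mul_ofReal,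
    Real.fourierChar_apply, e2]
  rw [Complex.exp_ofReal_mul_I_re, cos_neg, mul_comm]

lemma two_mul_sin_mul_sum_sin (N : ℕ) (x : ℝ) :
    2 * (∑ n ∈ Finset.range N, sin (2 * ((n : ℝ) + 1) * x)) * sin x
      = cos x - cos ((2 * N + 1) * x) := by
  induction N with
  | zero => simp
  | succ N ih =>
    rw [Finset.sum_range_succ, mul_add, add_mul, ih]
    have e1 : (2 * (N : ℝ) + 1) * x = 2 * (N + 1) * x - x := by ring
    have e2 : (2 * ((N + 1 : ℕ) : ℝ) + 1) * x = 2 * (N + 1) * x + x := by push_cast; ring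
    rw [e1, e2, cos_sub, cos_add]
    ring

/-- Two integrations by parts against a sine. -/
lemma integral_eval_mul_sin (f : ℝ[X]) (n : ℕ) :
    ∫ x in (0 : ℝ)..π / 2, f.eval x * sin (2 * ((n : ℝ) + 1) * x)
      = 1 / (2 * ((n : ℝ) + 1)) * (f.eval 0 + (-1) ^ n * f.eval (π / 2))
        - 1 / (2 * ((n : ℝ) + 1)) ^ 2
          * ∫ x in (0 : ℝ)..π / 2,
              (derivative (derivative f)).eval x * sin (2 * ((n : ℝ) + 1) * x) := by
  set c : ℝ := 2 * ((n : ℝ) + 1) with hc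
  have hc0 : c ≠ 0 := by positivity
  have hlin : ∀ x, HasDerivAt (fun x => c * x) c x := fun x => by
    simpa using (hasDerivAt_id x).const_mul c
  have hF : ∀ x, HasDerivAt
      (fun x => -(1 / c) * (f.eval x * cos (c * x))
        + 1 / c ^ 2 * ((derivative f).eval x * sin (c * x)))
      (f.eval x * sin (c * x)
        + 1 / c ^ 2 * ((derivative (derivative f)).eval x * sin (c * x))) x := by
    intro x
    have h1 := ((Polynomial.hasDerivAt f x).mul (hlin x).cos).const_mul (-(1 / c))
    have h2 := ((Polynomial.hasDerivAt (derivative f) x).mul (hlin x).sin).const_mul (1 / c ^ 2)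
    refine (h1.add h2).congr_deriv ?_
    field_simp
    ring
  have hi1 : IntervalIntegrable (fun x => f.eval x * sin (c * x)) MeasureTheory.volume 0 (π / 2) :=
    (by fun_prop : Continuous _).intervalIntegrable _ _
  have hi2 : IntervalIntegrable
      (fun x => 1 / c ^ 2 * ((derivative (derivative f)).eval x * sin (c * x)))
      MeasureTheory.volume 0 (π / 2) :=
    (by fun_prop : Continuous _).intervalIntegrable _ _
  have h := intervalIntegral.integral_eq_sub_of_hasDerivAt (fun x _ => hF x) (hi1.add hi2)
  rw [intervalIntegral.integral_add hi1 hi2, intervalIntegral.integral_const_mul] at h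
  have e1 : c * (π / 2) = ((n + 1 : ℕ) : ℝ) * π := by rw [hc]; push_cast; ring
  rw [e1, cos_nat_mul_pi, sin_nat_mul_pi] at h
  simp only [mul_zero, cos_zero, sin_zero, mul_one, add_zero] at h
  rw [pow_succ] at h
  linear_combination h

lemma integral_eval_mul_sin_eq_sum (R : ℕ) (f : ℝ[X]) (hf : derivative^[2 * R] f = 0) (n : ℕ) :
    ∫ x in (0 : ℝ)..π / 2, f.eval x * sin (2 * ((n : ℝ) + 1) * x)
      = ∑ r ∈ Finset.range R, (-1) ^ r * (1 / (2 * ((n : ℝ) + 1)) ^ (2 * r + 1))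
        * ((derivative^[2 * r] f).eval 0 + (-1) ^ n * (derivative^[2 * r] f).eval (π / 2)) := by
  induction R generalizing f with
  | zero =>
    have hf0 : f = 0 := by simpa using hf
    simp [hf0]
  | succ R ih =>
    have hf' : derivative^[2 * R] (derivative (derivative f)) = 0 := by
      rwa [← Function.iterate_succ_apply, ← Function.iterate_succ_apply]
    rw [integral_eval_mul_sin, ih _ hf', Finset.sum_range_succ', Finset.mul_sum, sub_eq_add_neg,
      ← Finset.sum_neg_distrib, add_comm]
    congr 1
    · refine Finset.sum_congr rfl fun r _ => ?_
      rw [← Function.iterate_succ_apply derivative, ← Function.iterate_succ_apply derivative,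
        show (2 * r).succ.succ = 2 * (r + 1) by omega]
      have : (2 * ((n : ℝ) + 1)) ≠ 0 := by positivity
      field_simp
      ring
    · simp

/-- The value `ζ(2 r + 1)`, as a real series. -/
noncomputable def oddZeta (r : ℕ) : ℝ := ∑' n : ℕ, 1 / ((n : ℝ) + 1) ^ (2 * r + 1)

lemma riemannZeta_eq_oddZeta {r : ℕ} (hr : 1 ≤ r) :
    riemannZeta (2 * (r : ℂ) + 1) = (oddZeta r : ℂ) := by
  have h := zeta_eq_tsum_one_div_nat_add_one_cpow (s := 2 * (r : ℂ) + 1) (by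
    simp; omega)
  rw [h, oddZeta, Complex.ofReal_tsum]
  refine tsum_congr fun n => ?_
  rw [show (2 * (r : ℂ) + 1) = ((2 * r + 1 : ℕ) : ℂ) by push_cast; ring, Complex.cpow_natCast]
  push_cast
  rfl

lemma tendsto_sum_oddZeta {r : ℕ} (hr : 1 ≤ r) :
    Filter.Tendsto (fun N => ∑ n ∈ Finset.range N, 1 / ((n : ℝ) + 1) ^ (2 * r + 1)) Filter.atTop
      (nhds (oddZeta r)) := by
  have h : Summable fun n : ℕ => 1 / ((n : ℝ) + 1) ^ (2 * r + 1) := by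
    have := (summable_nat_add_iff 1).2
      (Real.summable_one_div_nat_pow.2 (by omega : 1 < 2 * r + 1))
    simpa using this
  exact h.hasSum.tendsto_sum_nat

lemma sum_range_two_mul_alternating (s N : ℕ) :
    ∑ n ∈ Finset.range (2 * N), (-1) ^ n * (1 / ((n : ℝ) + 1) ^ s)
      = ∑ n ∈ Finset.range (2 * N), 1 / ((n : ℝ) + 1) ^ s
        - 2 / 2 ^ s * ∑ n ∈ Finset.range N, 1 / ((n : ℝ) + 1) ^ s := by
  induction N with
  | zero => simp
  | succ N ih =>
    rw [show 2 * (N + 1) = 2 * N + 1 + 1 by ring, Finset.sum_range_succ, Finset.sum_range_succ,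
      Finset.sum_range_succ, Finset.sum_range_succ, Finset.sum_range_succ, ih]
    rw [pow_succ, pow_mul]
    push_cast
    rw [show 2 * (N : ℝ) + 1 + 1 = 2 * (N + 1) by ring, mul_pow]
    have : ((N : ℝ) + 1) ^ s ≠ 0 := by positivity
    field_simp
    ring

lemma tendsto_two_mul : Filter.Tendsto (fun N : ℕ => 2 * N) Filter.atTop Filter.atTop :=
  Filter.tendsto_id.const_mul_atTop' two_pos

lemma tendsto_alternating_oddZeta {r : ℕ} (hr : 1 ≤ r) :
    Filter.Tendsto
      (fun N => ∑ n ∈ Finset.range (2 * N), (-1) ^ n * (1 / ((n : ℝ) + 1) ^ (2 * r + 1)))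
      Filter.atTop (nhds ((1 - 1 / 2 ^ (2 * r)) * oddZeta r)) := by
  have h := ((tendsto_sum_oddZeta hr).comp tendsto_two_mul).sub
    ((tendsto_sum_oddZeta hr).const_mul (2 / 2 ^ (2 * r + 1)))
  have e : oddZeta r - 2 / 2 ^ (2 * r + 1) * oddZeta r = (1 - 1 / 2 ^ (2 * r)) * oddZeta r := by
    rw [pow_succ]; field_simp
  rw [e] at h
  exact h.congr fun N => (sum_range_two_mul_alternating _ N).symm

/-- The partial sums of even length of the alternating harmonic series are `H_{2N} - H_N`. -/
lemma tendsto_alternating_harmonic :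
    Filter.Tendsto (fun N => ∑ n ∈ Finset.range (2 * N), (-1) ^ n * (1 / ((n : ℝ) + 1)))
      Filter.atTop (nhds (log 2)) := by
  have h := ((tendsto_harmonic_sub_log.comp tendsto_two_mul).sub tendsto_harmonic_sub_log).add_const
    (log 2)
  rw [sub_self, zero_add] at h
  refine h.congr' ?_
  filter_upwards [Filter.eventually_ge_atTop 1] with N hN
  have hs := sum_range_two_mul_alternating 1 N
  simp only [pow_one, div_self (two_ne_zero' ℝ), one_mul] at hs
  rw [hs]
  have hN0 : (N : ℝ) ≠ 0 := by positivity
  have hh : ∀ M : ℕ, (harmonic M : ℝ) = ∑ n ∈ Finset.range M, 1 / ((n : ℝ) + 1) := by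
    intro M; simp [harmonic]
  simp only [Function.comp_apply]
  rw [← hh, ← hh]
  push_cast
  rw [log_mul two_ne_zero hN0]
  ring

/-- The integral of `f(x) cot x` over `[0, π / 2]`, for a polynomial `f` vanishing at `0`. Writing
`f = X * q`, the integrand is `q(x)` times `x cot x`. -/
lemma integral_mulCot (R : ℕ) {f q : ℝ[X]} (hq : f = X * q)
    (hf : derivative^[2 * (R + 1)] f = 0) :
    ∫ x in (0 : ℝ)..π / 2, q.eval x * mulCot x
      = ∑ r ∈ Finset.Icc 1 R, (-1) ^ r * (1 / 2 ^ (2 * r)) * oddZeta r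
          * ((derivative^[2 * r] f).eval 0
            + (1 - 1 / 2 ^ (2 * r)) * (derivative^[2 * r] f).eval (π / 2))
        + log 2 * f.eval (π / 2) := by
  have hf0 : f.eval 0 = 0 := by simp [hq]
  -- the partial sums of the sine coefficients of `f` are a cotangent integral up to an error
  -- that vanishes by the Riemann–Lebesgue lemma
  have hcont : ContinuousOn (fun x => q.eval x / sinc x) (Set.Icc 0 (π / 2)) :=
    (Polynomial.continuous _).continuousOn.div continuous_sinc.continuousOn
      fun _ hx => (sinc_pos_of_mem hx).ne'
  have hpart : ∀ N : ℕ, ∑ n ∈ Finset.range N,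
      2 * ∫ x in (0 : ℝ)..π / 2, f.eval x * sin (2 * ((n : ℝ) + 1) * x)
      = (∫ x in (0 : ℝ)..π / 2, q.eval x * mulCot x)
        - ∫ x in (0 : ℝ)..π / 2, q.eval x / sinc x * cos ((2 * N + 1) * x) := by
    intro N
    have hi : IntervalIntegrable (fun x => q.eval x / sinc x * cos ((2 * N + 1) * x))
        MeasureTheory.volume 0 (π / 2) := by
      refine ContinuousOn.intervalIntegrable ?_
      rw [Set.uIcc_of_le (by positivity)]
      exact hcont.mul (by fun_prop : Continuous _).continuousOn
    rw [← intervalIntegral.integral_sub (intervalIntegrable_eval_mul_mulCot q) hi]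
    simp only [← intervalIntegral.integral_const_mul]
    rw [← intervalIntegral.integral_finsetSum
      fun n _ => (by fun_prop : Continuous _).intervalIntegrable _ _]
    refine intervalIntegral.integral_congr fun x hx => ?_
    rw [Set.uIcc_of_le (by positivity)] at hx
    have hs := (sinc_pos_of_mem hx).ne'
    have hx' : x * sinc x = sin x := by
      rcases eq_or_ne x 0 with h | h
      · simp [h]
      · rw [sinc_of_ne_zero h]; field_simp
    have hsum := two_mul_sin_mul_sum_sin N x
    rw [← hx'] at hsum
    simp only [hq, eval_mul, eval_X, mulCot]
    rw [← Finset.mul_sum, ← Finset.mul_sum]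
    have hdiv : q.eval x * (cos x / sinc x) - q.eval x / sinc x * cos ((2 * N + 1) * x)
        = q.eval x / sinc x * (cos x - cos ((2 * N + 1) * x)) := by ring
    rw [hdiv, ← hsum, div_mul_eq_mul_div, eq_div_iff hs]
    ring
  have hlim1 : Filter.Tendsto (fun N : ℕ => ∑ n ∈ Finset.range (2 * N),
      2 * ∫ x in (0 : ℝ)..π / 2, f.eval x * sin (2 * ((n : ℝ) + 1) * x)) Filter.atTop
      (nhds (∫ x in (0 : ℝ)..π / 2, q.eval x * mulCot x)) := by
    simp only [hpart]
    simpa using ((tendsto_integral_mul_cos hcont).comp tendsto_two_mul).const_sub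
      (∫ x in (0 : ℝ)..π / 2, q.eval x * mulCot x)
  have hexp : ∀ N : ℕ, ∑ n ∈ Finset.range (2 * N),
      2 * ∫ x in (0 : ℝ)..π / 2, f.eval x * sin (2 * ((n : ℝ) + 1) * x)
      = ∑ r ∈ Finset.Icc 1 R, (-1) ^ r * (1 / 2 ^ (2 * r))
          * ((derivative^[2 * r] f).eval 0
              * (∑ n ∈ Finset.range (2 * N), 1 / ((n : ℝ) + 1) ^ (2 * r + 1))
            + (derivative^[2 * r] f).eval (π / 2)
              * ∑ n ∈ Finset.range (2 * N), (-1) ^ n * (1 / ((n : ℝ) + 1) ^ (2 * r + 1)))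
        + f.eval (π / 2) * ∑ n ∈ Finset.range (2 * N), (-1) ^ n * (1 / ((n : ℝ) + 1)) := by
    intro N
    have hsplit : ∀ F : ℕ → ℝ,
        ∑ r ∈ Finset.range (R + 1), F r = ∑ r ∈ Finset.Icc 1 R, F r + F 0 := by
      intro F
      rw [Finset.range_eq_Ico, Finset.sum_eq_sum_Ico_succ_bot (Nat.succ_pos R), add_comm]
      rfl
    have hterm : ∀ n : ℕ, 2 * ∫ x in (0 : ℝ)..π / 2, f.eval x * sin (2 * ((n : ℝ) + 1) * x) = _ :=
      fun n => by rw [integral_eval_mul_sin_eq_sum (R + 1) f hf, hsplit, mul_add]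
    rw [Finset.sum_congr rfl fun n _ => hterm n, Finset.sum_add_distrib]
    congr 1
    · simp only [Finset.mul_sum]
      rw [Finset.sum_comm]
      refine Finset.sum_congr rfl fun r _ => ?_
      rw [← Finset.sum_add_distrib, Finset.mul_sum]
      refine Finset.sum_congr rfl fun n _ => ?_
      have : ((n : ℝ) + 1) ≠ 0 := by positivity
      rw [mul_pow, pow_succ (2 : ℝ)]
      field_simp
    · rw [Finset.mul_sum]
      refine Finset.sum_congr rfl fun n _ => ?_
      have : ((n : ℝ) + 1) ≠ 0 := by positivity
      simp only [pow_zero, mul_zero, zero_add, pow_one, Function.iterate_zero, id_eq, hf0]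
      field_simp
  refine tendsto_nhds_unique hlim1 ?_
  simp only [hexp]
  rw [mul_comm (log 2)]
  refine Filter.Tendsto.add ?_ (tendsto_alternating_harmonic.const_mul _)
  refine tendsto_finsetSum _ fun r hr => ?_
  have hr1 := (Finset.mem_Icc.1 hr).1
  have h := ((((tendsto_sum_oddZeta hr1).comp tendsto_two_mul).const_mul
    ((derivative^[2 * r] f).eval 0)).add ((tendsto_alternating_oddZeta hr1).const_mul
      ((derivative^[2 * r] f).eval (π / 2)))).const_mul ((-1) ^ r * (1 / 2 ^ (2 * r)))
  refine (h.congr fun N => rfl).mono_right (le_of_eq (congrArg nhds ?_))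
  ring

/-! ### Derivatives of the product of two Green polynomials -/

/-- The reflection `x ↦ π / 2 - x`. -/
noncomputable def reflect (p : ℝ[X]) : ℝ[X] := p.comp (C (π / 2) - X)

lemma eval_reflect (p : ℝ[X]) (x : ℝ) : (reflect p).eval x = p.eval (π / 2 - x) := by
  simp [reflect]

lemma reflect_mul (p q : ℝ[X]) : reflect (p * q) = reflect p * reflect q := mul_comp _ _ _

lemma reflect_reflect (p : ℝ[X]) : reflect (reflect p) = p := by
  simp [reflect, comp_assoc]

lemma iterate_derivative_reflect (p : ℝ[X]) (k : ℕ) :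
    derivative^[k] (reflect p) = (-1) ^ k * reflect (derivative^[k] p) := by
  induction k generalizing p with
  | zero => simp
  | succ k ih =>
    have h : derivative (reflect p) = -reflect (derivative p) := by
      simp [reflect, derivative_comp]
    rw [Function.iterate_succ_apply, h, iterate_derivative_neg, ih, Function.iterate_succ_apply]
    ring

lemma eval_pi_div_two_iterate_derivative_greenPoly (a j : ℕ) :
    (derivative^[2 * j] (greenPoly a)).eval (π / 2) = if j = a then (-1) ^ a else 0 := by
  rw [iterate_derivative_greenPoly]
  rcases lt_trichotomy j a with h | h | h
  · obtain ⟨c, rfl⟩ := Nat.exists_eq_add_of_lt h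
    rw [if_pos (by omega), if_neg (by omega), show j + c + 1 - j = c + 1 by omega, eval_mul,
      eval_pi_div_two_greenPoly, mul_zero]
  · subst h
    rw [if_pos le_rfl, if_pos rfl, Nat.sub_self, greenPoly]
    simp
  · rw [if_neg (by omega), if_neg (by omega), eval_zero]

/-- The product `dᵦ(x) dₐ(π / 2 - x)`. -/
noncomputable def greenProd (a b : ℕ) : ℝ[X] := greenPoly b * reflect (greenPoly a)

/-- In the Leibniz formula at `0` only the term with `2 a` derivatives on the reflected factor
survives. -/
lemma eval_zero_iterate_derivative_greenProd (a b : ℕ) {r : ℕ} (hr : r ≤ a + b) :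
    (derivative^[2 * r] (greenProd a b)).eval 0
      = (-1) ^ r * ((2 * r).choose (2 * a) * (greenPoly (a + b - r)).eval 0) := by
  rw [greenProd, iterate_derivative_mul, eval_finsetSum]
  have hterm : ∀ k, (derivative^[k] (reflect (greenPoly a))).eval 0
      = (-1) ^ k * (derivative^[k] (greenPoly a)).eval (π / 2) := by
    intro k
    rw [iterate_derivative_reflect, eval_mul, eval_reflect, sub_zero]
    simp
  rw [Finset.sum_eq_single (2 * a)]
  · rcases le_or_gt a r with h | h
    · rw [eval_smul, eval_mul, hterm, eval_pi_div_two_iterate_derivative_greenPoly, if_pos rfl,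
        ← Nat.mul_sub, iterate_derivative_greenPoly, if_pos (by omega),
        show b - (r - a) = a + b - r by omega]
      obtain ⟨c, rfl⟩ := Nat.exists_eq_add_of_le h
      rw [Nat.add_sub_cancel_left, pow_mul, nsmul_eq_mul]
      simp
      ring
    · rw [Nat.choose_eq_zero_of_lt (by omega)]
      simp
  · intro k hk hka
    rw [eval_smul, eval_mul, hterm]
    obtain ⟨j, rfl | rfl⟩ := k.even_or_odd'
    · rw [eval_pi_div_two_iterate_derivative_greenPoly, if_neg (by omega)]
      simp
    · have := Finset.mem_range.1 hk
      rw [show 2 * r - (2 * j + 1) = 2 * (r - j - 1) + 1 by omega,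
        iterate_derivative_odd_greenPoly_eval_zero]
      simp
  · intro h
    rw [Nat.choose_eq_zero_of_lt (by simpa using h)]
    simp

lemma reflect_greenProd (a b : ℕ) : reflect (greenProd a b) = greenProd b a := by
  rw [greenProd, greenProd, reflect_mul, reflect_reflect, mul_comm]

lemma eval_pi_div_two_iterate_derivative_greenProd (a b : ℕ) {r : ℕ} (hr : r ≤ a + b) :
    (derivative^[2 * r] (greenProd a b)).eval (π / 2)
      = (-1) ^ r * ((2 * r).choose (2 * b) * (greenPoly (a + b - r)).eval 0) := by
  rw [add_comm a b, ← eval_zero_iterate_derivative_greenProd b a (by omega), ← reflect_greenProd,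
    iterate_derivative_reflect, eval_mul, eval_reflect, sub_self, pow_mul]
  simp

lemma iterate_derivative_greenProd_eq_zero (a b : ℕ) :
    derivative^[2 * (a + b + 1)] (greenProd a b) = 0 := by
  refine iterate_derivative_eq_zero ?_
  have h1 := natDegree_greenPoly_le a
  have h2 := natDegree_greenPoly_le b
  have h3 : (reflect (greenPoly a)).natDegree ≤ 2 * a := by
    refine natDegree_comp_le.trans ?_
    have : (C (π / 2) - X : ℝ[X]).natDegree ≤ 1 :=
      (natDegree_sub_le _ _).trans (by simp)
    nlinarith
  have := natDegree_mul_le (p := greenPoly b) (q := reflect (greenPoly a))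
  rw [greenProd]
  omega

lemma greenPoly_eval_pi_div_two (n : ℕ) :
    (greenPoly n).eval (π / 2) = if n = 0 then 1 else 0 := by
  cases n <;> simp [greenPoly]

/-- The evaluation of the regularized values, with the zeta values written as real series. -/
theorem tStarReg_two_one_two (V : ℝ) (a b : ℕ) :
    tStarReg V (List.replicate a 2 ++ 1 :: List.replicate b 2)
      = ∑ r ∈ Finset.Icc 1 (a + b), 1 / 2 ^ (2 * r)
          * (((2 * r).choose (2 * a) : ℝ) + (1 - 1 / 2 ^ (2 * r)) * ((2 * r).choose (2 * b) : ℝ))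
          * tStar (List.replicate (a + b - r) 2) * oddZeta r
        + (if a = 0 then (V - log 2) * tStar (List.replicate b 2) else 0)
        + (if b = 0 then log 2 * tStar (List.replicate a 2) else 0) := by
  simp only [tStar_two]
  have hsum : ∀ f : ℝ[X], (∀ r, 1 ≤ r → derivative^[2 * r] f = derivative^[2 * r] (greenProd a b)) →
      ∑ r ∈ Finset.Icc 1 (a + b), (-1) ^ r * (1 / 2 ^ (2 * r)) * oddZeta r
          * ((derivative^[2 * r] f).eval 0
            + (1 - 1 / 2 ^ (2 * r)) * (derivative^[2 * r] f).eval (π / 2))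
      = ∑ r ∈ Finset.Icc 1 (a + b), 1 / 2 ^ (2 * r)
          * (((2 * r).choose (2 * a) : ℝ) + (1 - 1 / 2 ^ (2 * r)) * ((2 * r).choose (2 * b) : ℝ))
          * (greenPoly (a + b - r)).eval 0 * oddZeta r := by
    intro f hf
    refine Finset.sum_congr rfl fun r hr => ?_
    obtain ⟨hr1, hr2⟩ := Finset.mem_Icc.1 hr
    rw [hf r hr1, eval_zero_iterate_derivative_greenProd a b hr2,
      eval_pi_div_two_iterate_derivative_greenProd a b hr2]
    have h1 : ((-1 : ℝ) ^ r) * (-1) ^ r = 1 := by rw [← mul_pow]; simp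
    linear_combination (1 / 2 ^ (2 * r) * oddZeta r * (((2 * r).choose (2 * a) : ℝ)
      + (1 - 1 / 2 ^ (2 * r)) * ((2 * r).choose (2 * b) : ℝ))
      * (greenPoly (a + b - r)).eval 0) * h1
  cases a with
  | zero =>
    -- subtracting the constant `dᵦ(0)` changes no derivative of positive order
    obtain ⟨q, hq⟩ := exists_greenPoly_sub_eq b
    have hprod : greenProd 0 b = greenPoly b := by simp [greenProd, greenPoly, reflect]
    have hder : ∀ r, 1 ≤ r → derivative^[2 * r] (greenPoly b - C ((greenPoly b).eval 0))
        = derivative^[2 * r] (greenProd 0 b) := by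
      intro r hr
      rw [iterate_derivative_sub, iterate_derivative_C (by omega), sub_zero, hprod]
    have hzero : derivative^[2 * (0 + b + 1)] (greenPoly b - C ((greenPoly b).eval 0)) = 0 := by
      rw [hder _ (by omega)]; exact iterate_derivative_greenProd_eq_zero 0 b
    rw [List.replicate_zero, List.nil_append, tStarReg_one_two_eq_integral V b hq,
      integral_mulCot (0 + b) hq hzero, hsum _ hder, eval_sub, eval_C, greenPoly_eval_pi_div_two]
    simp only [if_true, greenPoly, eval_one]
    split_ifs <;> ring
  | succ a =>
    obtain ⟨q, hq⟩ : X ∣ reflect (greenPoly (a + 1)) := by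
      rw [X_dvd_iff, coeff_zero_eq_eval_zero, eval_reflect, sub_zero, eval_pi_div_two_greenPoly]
    have hf : greenProd (a + 1) b = X * (greenPoly b * q) := by rw [greenProd, hq]; ring
    rw [tStarReg_two_succ_eq_integral V a b hq, integral_mulCot (a + 1 + b) hf
      (iterate_derivative_greenProd_eq_zero _ _), hsum _ fun _ _ => rfl, greenProd, eval_mul,
      eval_reflect, sub_self, greenPoly_eval_pi_div_two, if_neg (Nat.succ_ne_zero a), add_zero]
    congr 1
    split_ifs <;> ring

end MultipleT

theorem mainTheorem4 (V : ℝ) (a b : ℕ) :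
    ((MultipleT.tStarReg V (List.replicate a 2 ++ 1 :: List.replicate b 2) : ℝ) : ℂ) =
      (∑ r ∈ Finset.Icc 1 (a + b),
        1 / (2 : ℂ) ^ (2 * r)
          * (((2 * r).choose (2 * a) : ℂ)
              + (1 - 1 / (2 : ℂ) ^ (2 * r)) * ((2 * r).choose (2 * b) : ℂ))
          * (MultipleT.tStar (List.replicate (a + b - r) 2) : ℂ)
          * riemannZeta (2 * (r : ℂ) + 1))
      + (if a = 0 then
          ((V : ℂ) - (Real.log 2 : ℂ)) * (MultipleT.tStar (List.replicate b 2) : ℂ) else 0)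
      + (if b = 0 then
          (Real.log 2 : ℂ) * (MultipleT.tStar (List.replicate a 2) : ℂ) else 0) := by
  rw [MultipleT.tStarReg_two_one_two]
  push_cast
  congr 2
  · refine Finset.sum_congr rfl fun r hr => ?_
    rw [MultipleT.riemannZeta_eq_oddZeta (Finset.mem_Icc.1 hr).1]
  · split_ifs <;> simp
  · split_ifs <;> simp
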